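/- Let $d\ge 0$ be an integer and let $ID$ be the class of infinitely divisible probability measures on $\mathbb{R}^d$. For $\nu\in ID$ let $Y_\nu(t)$, $t\ge 0$, be an $\mathbb{R}^d$-valued Lévy process (stationary independent increments, $Y_\nu(0)=0$, right-continuous paths with finite left limits) such that $Y_\nu(1)$ has law $\nu$. For $\beta>0$ let $\mathcal{J}^\beta(\nu)$ be the law of $$\int_0^1 t^{1/\beta}\,dY_\nu(t) := Y_\nu(1)-\int_0^1 Y_\nu(t)\,d(t^{1/\beta}),$$ let $\mathcal{U}_\beta := \{\mathcal{J}^\beta(\nu) : \nu\in ID\}$, and let $\nu^{*1/2}$ be the convolution square root of $\nu$. These are well defined: for all $\nu\in ID$ and $\gamma>0$ a process $Y_\nu$ exists, the law $\mathcal{J}^\gamma(\nu)$ does not depend on its choice and belongs to $ID$, and there is exactly one probability measure $\nu^{*1/2}$ with $\nu^{*1/2}*\nu^{*1/2}=\nu$, and it belongs to $ID$. Let $\beta>0$. Then: 1. For every $\rho\in ID$: $\ \mathcal{J}^\beta(\rho)*\rho\in\mathcal{U}_\beta$ if and only if $\rho\in\mathcal{U}_{2\beta}$. 2. For all $\rho,\nu\in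 ID$: $\ \mathcal{J}^\beta(\rho)*\rho=\mathcal{J}^\beta(\nu)$ if and only if $\rho=\mathcal{J}^{2\beta}(\nu^{*1/2})$. 3. For every $\tilde\mu\in\mathcal{U}_\beta$ there is exactly one $\tilde\rho\in\mathcal{U}_{2\beta}$ such that $\tilde\mu=\mathcal{J}^\beta(\tilde\rho)*\tilde\rho$, and this $\tilde\rho$ satisfies $\mathcal{J}^{2\beta}(\tilde\mu)=\mathcal{J}^\beta(\tilde\rho^{*2})$. -/

import Mathlib

open MeasureTheory ProbabilityTheory Filter Topology
open scoped NNReal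

noncomputable section

namespace FactorizationProperty

/-- Euclidean space `ℝ^d`. -/
abbrev E (d : ℕ) : Type := EuclideanSpace ℝ (Fin d)

/-- The `n`-fold convolution `μ^{*n}`. -/
def convPow {d : ℕ} (μ : Measure (E d)) : ℕ → Measure (E d)
  | 0 => Measure.dirac 0
  | n + 1 => convPow μ n ∗ μ

/-- The class `ID`: `μ` is a probability measure which for every `n ≥ 1` is the `n`-fold
convolution of some probability measure. -/
def InfDiv {d : ℕ} (μ : Measure (E d)) : Prop :=
  IsProbabilityMeasure μ ∧
    ∀ n : ℕ, 1 ≤ n → ∃ ν : Measure (E d), IsProbabilityMeasure ν ∧ convPow ν n = μ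

/-- `σ` is a convolution square root of `ν`: a probability measure with `σ * σ = ν`. -/
def IsConvSqrt {d : ℕ} (ν σ : Measure (E d)) : Prop :=
  IsProbabilityMeasure σ ∧ σ ∗ σ = ν

/-- The convolution power `ν^{*1/2}`, i.e. the convolution square root of `ν`. -/
def convSqrt {d : ℕ} (ν : Measure (E d)) : Measure (E d) :=
  Classical.epsilon (IsConvSqrt ν)

/-- Lévy processes `Y(t)`, `t ≥ 0`, with values in `ℝ^d`: stationary independent increments,
started at zero, with paths that are right continuous and have (finite) left limits. -/
structure IsLevyProcess {d : ℕ} {Ω : Type*} [MeasurableSpace Ω] (P : Measure Ω)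
    (Y : ℝ≥0 → Ω → E d) : Prop where
  measurable : ∀ t, Measurable (Y t)
  zero : ∀ ω, Y 0 ω = 0
  indep : HasIndepIncrements Y P
  stationary : ∀ s t, P.map (fun ω => Y (s + t) ω - Y s ω) = P.map (Y t)
  right_cont : ∀ ω t, ContinuousWithinAt (fun s => Y s ω) (Set.Ioi t) t
  left_lim : ∀ ω t, ∃ l : E d, Tendsto (fun s => Y s ω) (𝓝[<] t) (𝓝 l)

/-- The random integral `∫_0^1 f(t) dY(t)` of a deterministic function `f` with respect to a
process `Y` with càdlàg paths, defined pathwise through integration by parts,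
`∫_0^1 f(t) dY(t) = f(1) Y(1) - f(0) Y(0) - ∫_0^1 Y(t) df(t)`.
This is for `f` absolutely continuous on `[0, 1]`, so that `df(t) = f'(t) dt`; as `Y(t) = Y(t-)`
for all but countably many `t`, it does not matter which of the two stands in the integral. -/
def randomIntegral {d : ℕ} {Ω : Type*} (f : ℝ → ℝ) (Y : ℝ≥0 → Ω → E d) (ω : Ω) : E d :=
  f 1 • Y 1 ω - f 0 • Y 0 ω - ∫ t in (0 : ℝ)..1, deriv f t • Y t.toNNReal ω

/-- `μ` is the law of `∫_0^1 t^{1/β} dY(t)` for some Lévy process `Y` such that `Y(1)` has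
law `ν`. -/
def IsRandomIntegralLaw {d : ℕ} (β : ℝ) (ν μ : Measure (E d)) : Prop :=
  ∃ (Ω : Type) (_ : MeasurableSpace Ω) (P : Measure Ω) (Y : ℝ≥0 → Ω → E d),
    IsProbabilityMeasure P ∧ IsLevyProcess P Y ∧ HasLaw (Y 1) ν P ∧
      HasLaw (randomIntegral (fun t : ℝ => t ^ (1 / β)) Y) μ P

/-- The measure `J^β(ν)`, the law of `∫_0^1 t^{1/β} dY_ν(t)`. -/
def J {d : ℕ} (β : ℝ) (ν : Measure (E d)) : Measure (E d) :=
  Classical.epsilon (IsRandomIntegralLaw β ν)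

/-- The class `U_β = J^β(ID)` of generalized s-selfdecomposable distributions on `ℝ^d`. -/
def U (d : ℕ) (β : ℝ) : Set (Measure (E d)) :=
  {μ | ∃ ν : Measure (E d), InfDiv ν ∧ μ = J β ν}

end FactorizationProperty

end

open FactorizationProperty

namespace FactorizationProperty

/-! Everything is read off characteristic exponents. The characteristic function of an infinitely
divisible law has no zeros, so on the simply connected space `ℝ^d` it has a unique continuous
logarithm `ψ` with `ψ 0 = 0`. The exponent determines the law, convolution adds exponents, and the
convolution square root halves them. `J γ` acts linearly on exponents, sending `ψ` to `y ↦ ∫_0^1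
ψ(t^{1/γ} y) dt`.

The factorization is thereby an identity between continuous functions
(`integralExponent_add_eq_iff`). On the ray through `y` put `G(x) = ψ(x^{1/β} y)` and `H(x) =
χ(x^{1/β} y)`, with `χ` the exponent of `ν`. The equation says that the average of `G` over `[0, x]`
plus `G(x)` is the average of `H`; its only continuous solution is `G(x) = x⁻² ∫_0^x u H(u) du`.
Substituting `v = u²` turns this into half the exponent of `J (2 * β) ν`, which is where `2β` and
the square root come from. Membership in `U` and the unique factor follow, because every infinitely
divisible law is the square root of one; the last identity holds because the operators on exponents
commute by Fubini.

The analytic work is in showing that `J` is well defined. A Lévy process is built from nested random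
walks whose steps are the `2^n`-th roots of `ν`: Ottaviani's inequality bounds their oscillations
uniformly in `n`, which gives one-sided limits along the dyadics. The random integral is a pathwise
limit of Riemann–Stieltjes sums, whose characteristic functions are explicit. -/

variable {d : ℕ}

/-! ### Characteristic exponents -/

/-- `ψ` is the characteristic exponent of the probability measure `μ`: the continuous logarithm of
its characteristic function which vanishes at zero. -/
structure HasExponent (μ : Measure (E d)) (ψ : E d → ℂ) : Prop where
  isProb : IsProbabilityMeasure μ
  cont : Continuous ψ
  zero : ψ 0 = 0
  charFun_eq : ∀ y, charFun μ y = Complex.exp (ψ y)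

theorem continuous_charFun_of_isFiniteMeasure (μ : Measure (E d)) [IsFiniteMeasure μ] :
    Continuous (charFun μ) := by
  unfold charFun
  refine continuous_of_dominated (bound := fun _ => 1) (fun y => by fun_prop) (fun y => ?_)
    (by fun_prop) (ae_of_all _ fun x => by fun_prop)
  refine ae_of_all _ fun x => ?_
  rw [Complex.norm_exp_ofReal_mul_I]

/-- `exp` is a covering of the punctured plane, and two lifts of one map on a connected space
coincide once they agree at a point. -/
theorem eq_of_exp_eq_exp {ψ₁ ψ₂ : E d → ℂ} (h₁ : Continuous ψ₁) (h₂ : Continuous ψ₂)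
    (h0 : ψ₁ 0 = ψ₂ 0) (h : ∀ y, Complex.exp (ψ₁ y) = Complex.exp (ψ₂ y)) : ψ₁ = ψ₂ :=
  Complex.isCoveringMap_exp.eq_of_comp_eq h₁ h₂ (by ext y; simp [h y]) 0 h0

theorem HasExponent.unique {μ : Measure (E d)} {ψ₁ ψ₂ : E d → ℂ} (h₁ : HasExponent μ ψ₁)
    (h₂ : HasExponent μ ψ₂) : ψ₁ = ψ₂ :=
  eq_of_exp_eq_exp h₁.cont h₂.cont (by rw [h₁.zero, h₂.zero])
    fun y => by rw [← h₁.charFun_eq, h₂.charFun_eq]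

theorem HasExponent.measure_eq {μ ν : Measure (E d)} {ψ : E d → ℂ} (h₁ : HasExponent μ ψ)
    (h₂ : HasExponent ν ψ) : μ = ν := by
  have := h₁.isProb
  have := h₂.isProb
  refine Measure.ext_of_charFun ?_
  ext y
  rw [h₁.charFun_eq, h₂.charFun_eq]

theorem HasExponent.conv {μ ν : Measure (E d)} {ψ χ : E d → ℂ} (h₁ : HasExponent μ ψ)
    (h₂ : HasExponent ν χ) : HasExponent (μ ∗ ν) (fun y => ψ y + χ y) := by
  have := h₁.isProb
  have := h₂.isProb
  refine ⟨inferInstance, h₁.cont.add h₂.cont, by simp [h₁.zero, h₂.zero], fun y => ?_⟩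
  rw [charFun_conv, h₁.charFun_eq, h₂.charFun_eq, Complex.exp_add]

instance isProbabilityMeasure_convPow (μ : Measure (E d)) [IsProbabilityMeasure μ] (n : ℕ) :
    IsProbabilityMeasure (convPow μ n) := by
  induction n with
  | zero => exact inferInstanceAs (IsProbabilityMeasure (Measure.dirac 0))
  | succ n ih => exact inferInstanceAs (IsProbabilityMeasure (convPow μ n ∗ μ))

theorem charFun_convPow (μ : Measure (E d)) [IsProbabilityMeasure μ] (n : ℕ) (y : E d) :
    charFun (convPow μ n) y = charFun μ y ^ n := by
  induction n with
  | zero => simp [convPow, charFun_dirac]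
  | succ n ih => rw [convPow, charFun_conv, ih, pow_succ]

theorem HasExponent.convPow {μ : Measure (E d)} {ψ : E d → ℂ} (h : HasExponent μ ψ) (n : ℕ) :
    HasExponent (convPow μ n) (fun y => n * ψ y) := by
  have := h.isProb
  refine ⟨inferInstance, continuous_const.mul h.cont, by simp [h.zero], fun y => ?_⟩
  rw [charFun_convPow, h.charFun_eq, Complex.exp_nat_mul]

theorem exists_hasExponent (μ : Measure (E d)) [IsProbabilityMeasure μ]
    (h : ∀ y, charFun μ y ≠ 0) : ∃ ψ, HasExponent μ ψ := by
  have hsc : IsSimplyConnected (Set.univ : Set (E d)) :=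
    have := convex_univ.contractibleSpace (Set.univ_nonempty (α := E d))
    SimplyConnectedSpace.ofContractible _
  obtain ⟨f, hf, hfe⟩ := Complex.exists_continuousOn_eqOn_exp_comp hsc isOpen_univ
    (g := charFun μ) (continuous_charFun_of_isFiniteMeasure μ).continuousOn
    (by rintro ⟨y, -, hy⟩; exact h y hy)
  have hfe' : ∀ y, Complex.exp (f y) = charFun μ y := fun y => hfe (Set.mem_univ y)
  refine ⟨fun y => f y - f 0, inferInstance, ?_, by simp, fun y => ?_⟩
  · exact (continuousOn_univ.1 hf).sub continuous_const
  · rw [Complex.exp_sub, hfe', hfe']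
    simp

/-! ### Infinitely divisible laws and their roots -/

/-- Symmetrization: `‖charFun μ‖ ^ 2` is the characteristic function of a difference of two
independent copies, hence an integral of cosines, and `1 - cos 2a ≤ 4 (1 - cos a)`. -/
theorem one_sub_normSq_charFun_two_smul_le (μ : Measure (E d)) [IsProbabilityMeasure μ] (y : E d) :
    1 - ‖charFun μ ((2 : ℝ) • y)‖ ^ 2 ≤ 4 * (1 - ‖charFun μ y‖ ^ 2) := by
  set σ := μ ∗ (μ.map fun x => (-1 : ℝ) • x) with hσ
  have hm : IsProbabilityMeasure (μ.map fun x => (-1 : ℝ) • x) :=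
    Measure.isProbabilityMeasure_map (by fun_prop)
  have key : ∀ z, ‖charFun μ z‖ ^ 2 = ∫ x, Real.cos (inner ℝ x z) ∂σ := by
    intro z
    have h1 : charFun σ z = (‖charFun μ z‖ ^ 2 : ℝ) := by
      rw [hσ, charFun_conv, charFun_map_smul, neg_one_smul, charFun_neg, Complex.mul_conj,
        Complex.normSq_eq_norm_sq]
    have h2 : (charFun σ z).re = ∫ x, Real.cos (inner ℝ x z) ∂σ := by
      rw [charFun_apply, ← RCLike.re_eq_complex_re, ← integral_re]
      · simp [Complex.exp_ofReal_mul_I_re]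
      · refine Integrable.of_bound (C := 1) (by fun_prop) (ae_of_all _ fun x => ?_)
        rw [Complex.norm_exp_ofReal_mul_I]
    rw [← h2, h1, Complex.ofReal_re]
  have hint : ∀ z, Integrable (fun x => Real.cos (inner ℝ x z)) σ := fun z =>
    Integrable.of_bound (C := 1) (by fun_prop) (ae_of_all _ fun x => Real.abs_cos_le_one _)
  have e1 : ∀ z, 1 - ‖charFun μ z‖ ^ 2 = ∫ x, (1 - Real.cos (inner ℝ x z)) ∂σ := by
    intro z
    rw [integral_sub (integrable_const _) (hint z), key z]
    simp
  rw [e1, e1, ← integral_const_mul]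
  refine integral_mono ((integrable_const _).sub (hint _))
    (((integrable_const _).sub (hint _)).const_mul _) fun x => ?_
  simp only [inner_smul_right, Real.cos_two_mul]
  nlinarith [sq_nonneg (Real.cos (inner ℝ x y) - 1)]

/-- A zero at `2z` but not at `z` would force `‖charFun τ z‖ ^ 2 ≤ 3 / 4` for every root `τ`,
whereas these numbers tend to `1` as the order of the root grows. So a zero at `y` passes to all `y
/ 2 ^ k`, against continuity at `0`. -/
theorem InfDiv.charFun_ne_zero {ν : Measure (E d)} (h : InfDiv ν) (y : E d) : charFun ν y ≠ 0 := by
  have := h.1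
  have step : ∀ z, charFun ν z ≠ 0 → charFun ν ((2 : ℝ) • z) ≠ 0 := by
    intro z hz h2
    have hpos : 0 < ‖charFun ν z‖ := norm_pos_iff.2 hz
    have hbound : ∀ n : ℕ, ‖charFun ν z‖ ^ (2 / (n + 1 : ℝ)) ≤ 3 / 4 := by
      intro n
      obtain ⟨τ, hτ, hpow⟩ := h.2 (n + 1) (by omega)
      have h3 := one_sub_normSq_charFun_two_smul_le τ z
      have h4 : charFun τ ((2 : ℝ) • z) = 0 := by
        rw [← hpow, charFun_convPow] at h2
        exact pow_eq_zero_iff (by omega) |>.1 h2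
      have h5 : ‖charFun ν z‖ ^ (2 / (n + 1 : ℝ)) = ‖charFun τ z‖ ^ 2 := by
        rw [← hpow, charFun_convPow, norm_pow, ← Real.rpow_natCast, ← Real.rpow_mul (norm_nonneg _),
          ← Real.rpow_natCast _ 2]
        congr 1
        push_cast
        field_simp
      rw [h4] at h3
      rw [h5]
      norm_num at h3
      linarith
    have hlim : Tendsto (fun n : ℕ => ‖charFun ν z‖ ^ (2 / (n + 1 : ℝ))) atTop (𝓝 1) := by
      have := (tendsto_const_div_atTop_nhds_zero_nat (2 : ℝ)).comp (tendsto_add_atTop_nat 1)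
      have h6 := (Real.continuousAt_const_rpow (b := 0) hpos.ne').tendsto.comp this
      simpa [Function.comp_def] using h6
    have := le_of_tendsto' hlim hbound
    norm_num at this
  intro hy
  have hk : ∀ k : ℕ, charFun ν (((1 : ℝ) / 2) ^ k • y) = 0 := by
    intro k
    induction k with
    | zero => simpa using hy
    | succ k ih =>
      by_contra hne
      refine step _ hne ?_
      rw [smul_smul, pow_succ]
      convert ih using 3
      ring
  have hlim : Tendsto (fun k : ℕ => charFun ν (((1 : ℝ) / 2) ^ k • y)) atTop (𝓝 (charFun ν 0)) := by
    refine (continuous_charFun_of_isFiniteMeasure ν).continuousAt.tendsto.comp ?_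
    have : Tendsto (fun k : ℕ => ((1 : ℝ) / 2) ^ k) atTop (𝓝 0) :=
      tendsto_pow_atTop_nhds_zero_of_lt_one (by norm_num) (by norm_num)
    simpa using this.smul_const y
  simp only [hk] at hlim
  have := tendsto_nhds_unique hlim tendsto_const_nhds
  simp at this

theorem InfDiv.exists_hasExponent {ν : Measure (E d)} (h : InfDiv ν) : ∃ ψ, HasExponent ν ψ := by
  have := h.1
  exact FactorizationProperty.exists_hasExponent ν h.charFun_ne_zero

/-- A root has no zeros either, so it has an exponent, and `n` times that exponent is `ψ` by
uniqueness. In particular, roots are unique. -/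
theorem HasExponent.of_convPow_eq {ν τ : Measure (E d)} {ψ : E d → ℂ} (hν : HasExponent ν ψ)
    [IsProbabilityMeasure τ] {n : ℕ} (hn : n ≠ 0) (h : FactorizationProperty.convPow τ n = ν) :
    HasExponent τ (fun y => ψ y / n) := by
  obtain ⟨χ, hχ⟩ := FactorizationProperty.exists_hasExponent τ (fun y hy => by
    have h1 := hν.charFun_eq y
    rw [← h, charFun_convPow, hy, zero_pow hn] at h1
    exact Complex.exp_ne_zero _ h1.symm)
  have h2 := hχ.convPow n
  rw [h] at h2
  have h3 := h2.unique hν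
  convert hχ using 2 with y
  rw [← h3]
  field_simp

theorem InfDiv.exists_root {ν : Measure (E d)} (h : InfDiv ν) {ψ : E d → ℂ} (hν : HasExponent ν ψ)
    {n : ℕ} (hn : n ≠ 0) : ∃ τ, InfDiv τ ∧ HasExponent τ (fun y => ψ y / n) := by
  obtain ⟨τ, hτ, hpow⟩ := h.2 n (by omega)
  have hτe := hν.of_convPow_eq hn hpow
  refine ⟨τ, ⟨hτ, fun m hm => ?_⟩, hτe⟩
  -- The `m`-th root of the `n`-th root is the `nm`-th root of `ν`.
  obtain ⟨κ, hκ, hpow'⟩ := h.2 (n * m) (Nat.mul_pos (by omega) hm)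
  have hκe := hν.of_convPow_eq (Nat.mul_ne_zero hn (by omega)) hpow'
  refine ⟨κ, hκ, (hκe.convPow m).measure_eq ?_⟩
  convert hτe using 2 with y
  push_cast
  have : (m : ℂ) ≠ 0 := by exact_mod_cast (by omega : m ≠ 0)
  field_simp

theorem InfDiv.of_forall_hasExponent {μ : Measure (E d)} {ψ : E d → ℂ} (hμ : HasExponent μ ψ)
    (h : ∀ n : ℕ, 1 ≤ n → ∃ τ, HasExponent τ (fun y => ψ y / n)) : InfDiv μ := by
  refine ⟨hμ.isProb, fun n hn => ?_⟩
  obtain ⟨τ, hτ⟩ := h n hn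
  refine ⟨τ, hτ.isProb, (hτ.convPow n).measure_eq ?_⟩
  convert hμ using 2 with y
  have : (n : ℂ) ≠ 0 := by exact_mod_cast (by omega : n ≠ 0)
  field_simp

theorem InfDiv.conv {μ ν : Measure (E d)} (hμ : InfDiv μ) (hν : InfDiv ν) : InfDiv (μ ∗ ν) := by
  obtain ⟨ψ, hψ⟩ := hμ.exists_hasExponent
  obtain ⟨χ, hχ⟩ := hν.exists_hasExponent
  refine InfDiv.of_forall_hasExponent (hψ.conv hχ) fun n hn => ?_
  obtain ⟨τ, -, hτ⟩ := hμ.exists_root hψ (n := n) (by omega)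
  obtain ⟨κ, -, hκ⟩ := hν.exists_root hχ (n := n) (by omega)
  refine ⟨τ ∗ κ, ?_⟩
  convert hτ.conv hκ using 2
  ring

theorem convPow_two (μ : Measure (E d)) [IsProbabilityMeasure μ] : convPow μ 2 = μ ∗ μ := by
  simp [convPow]

theorem isConvSqrt_iff_hasExponent {ν σ : Measure (E d)} {ψ : E d → ℂ} (hν : HasExponent ν ψ) :
    IsConvSqrt ν σ ↔ HasExponent σ (fun y => ψ y / 2) := by
  constructor
  · rintro ⟨hσ, h⟩
    rw [← convPow_two] at h
    exact_mod_cast hν.of_convPow_eq two_ne_zero h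
  · intro h
    refine ⟨h.isProb, (h.conv h).measure_eq ?_⟩
    simpa using hν

theorem InfDiv.isConvSqrt_convSqrt {ν : Measure (E d)} (h : InfDiv ν) :
    IsConvSqrt ν (convSqrt ν) := by
  obtain ⟨ψ, hψ⟩ := h.exists_hasExponent
  obtain ⟨τ, -, hτ⟩ := h.exists_root hψ two_ne_zero
  exact Classical.epsilon_spec (p := IsConvSqrt ν)
    ⟨τ, (isConvSqrt_iff_hasExponent hψ).2 (by exact_mod_cast hτ)⟩

theorem InfDiv.hasExponent_convSqrt {ν : Measure (E d)} (h : InfDiv ν) {ψ : E d → ℂ}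
    (hψ : HasExponent ν ψ) : HasExponent (convSqrt ν) (fun y => ψ y / 2) :=
  (isConvSqrt_iff_hasExponent hψ).1 h.isConvSqrt_convSqrt

theorem InfDiv.isConvSqrt_iff {ν : Measure (E d)} (h : InfDiv ν) (σ : Measure (E d)) :
    IsConvSqrt ν σ ↔ σ = convSqrt ν := by
  obtain ⟨ψ, hψ⟩ := h.exists_hasExponent
  constructor
  · intro hσ
    exact ((isConvSqrt_iff_hasExponent hψ).1 hσ).measure_eq (h.hasExponent_convSqrt hψ)
  · rintro rfl
    exact h.isConvSqrt_convSqrt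

theorem InfDiv.convSqrt {ν : Measure (E d)} (h : InfDiv ν) : InfDiv (convSqrt ν) := by
  obtain ⟨ψ, hψ⟩ := h.exists_hasExponent
  obtain ⟨τ, hτ, hτe⟩ := h.exists_root hψ two_ne_zero
  have := (h.hasExponent_convSqrt hψ).measure_eq (by exact_mod_cast hτe)
  rwa [this]

/-! ### Nested random walks -/

section Tower

variable {V : Type*} [MeasurableSpace V]

theorem compProd_comap_map {W Z : Type*} [MeasurableSpace W] [MeasurableSpace Z] (μ : Measure W)
    [IsProbabilityMeasure μ] (κ : Kernel V Z) [IsMarkovKernel κ] {f : W → V} (hf : Measurable f) :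
    (μ.compProd (κ.comap f hf)).map (fun p => (f p.1, p.2)) = (μ.map f).compProd κ := by
  have : IsProbabilityMeasure (μ.map f) := Measure.isProbabilityMeasure_map hf.aemeasurable
  ext s hs
  rw [Measure.map_apply (by fun_prop) hs, Measure.compProd_apply (hs.preimage (by fun_prop)),
    Measure.compProd_apply hs, lintegral_map (Kernel.measurable_kernel_prodMk_left hs) hf]
  rfl

variable [StandardBorelSpace V] [Nonempty V]

/-- Probability measures which are compatible with a transition map are the marginal laws of a
sequence of random elements linked by that map. -/
theorem exists_measure_of_map_eq (Q : ℕ → Measure V) [∀ n, IsProbabilityMeasure (Q n)] {π : V → V}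
    (hπ : Measurable π) (h : ∀ n, (Q (n + 1)).map π = Q n) :
    ∃ P : Measure (ℕ → V), IsProbabilityMeasure P ∧ (∀ n, P.map (fun x => x n) = Q n) ∧
      ∀ᵐ x ∂P, ∀ n, x n = π (x (n + 1)) := by
  -- Given the present state, the next one is drawn from the conditional law under `Q (n + 1)` of an
  -- element given its image under `π`; consecutive states are then distributed as `(π v, v)` with
  -- `v` of law `Q (n + 1)`.
  let κ : (n : ℕ) → Kernel ((i : Finset.Iic n) → V) V := fun n =>
    (condDistrib id π (Q (n + 1))).comap (fun x => x ⟨n, Finset.mem_Iic.2 le_rfl⟩) (by fun_prop)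
  let P : Measure (ℕ → V) := Kernel.trajMeasure (X := fun _ => V) (Q 0) κ
  have hjoint : ∀ n, P.map (fun x => (x n, x (n + 1))) =
      (P.map (fun x => x n)).compProd (condDistrib id π (Q (n + 1))) := by
    intro n
    have h1 := Kernel.map_frestrictLe_trajMeasure_compProd_eq_map_trajMeasure
      (X := fun _ => V) (μ₀ := Q 0) (κ := κ) (a := n)
    have hpm : IsProbabilityMeasure (P.map (Preorder.frestrictLe (π := fun _ => V) n)) :=
      Measure.isProbabilityMeasure_map (by fun_prop)
    have h2 := compProd_comap_map (P.map (Preorder.frestrictLe (π := fun _ => V) n))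
      (condDistrib id π (Q (n + 1))) (f := fun x => x ⟨n, Finset.mem_Iic.2 le_rfl⟩) (by fun_prop)
    rw [Measure.map_map (by fun_prop) (by fun_prop)] at h2
    rw [show P.map (fun x => x n) = P.map ((fun x : (i : Finset.Iic n) → V =>
      x ⟨n, Finset.mem_Iic.2 le_rfl⟩) ∘ Preorder.frestrictLe (π := fun _ => V) n) from rfl, ← h2]
    change _ = Measure.map _ (Measure.compProd _ (κ n))
    rw [h1, Measure.map_map (by fun_prop) (by fun_prop)]
    rfl
  have hmarg : ∀ n, P.map (fun x => x n) = Q n := by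
    intro n
    induction n with
    | zero =>
      have h1 : P.map (Preorder.frestrictLe (π := fun _ => V) 0) =
          (Q 0).map (MeasurableEquiv.piUnique fun _ : Finset.Iic 0 => V).symm := by
        change (Kernel.trajMeasure (X := fun _ => V) (Q 0) κ).map _ = _
        rw [Kernel.trajMeasure, Measure.map_comp _ _ (by fun_prop), Kernel.traj_map_frestrictLe,
          Kernel.partialTraj_self, Measure.id_comp]
      rw [show P.map (fun x => x 0) = P.map ((fun x : (i : Finset.Iic 0) → V =>
        x ⟨0, Finset.mem_Iic.2 le_rfl⟩) ∘ Preorder.frestrictLe (π := fun _ => V) 0) from rfl,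
        ← Measure.map_map (by fun_prop) (by fun_prop), h1, Measure.map_map (by fun_prop) (by fun_prop)]
      exact Measure.map_id
    | succ n ih =>
      have h1 := hjoint n
      rw [ih, ← h n, compProd_map_condDistrib (by fun_prop)] at h1
      have h2 := congrArg (fun m => m.map Prod.snd) h1
      rw [Measure.map_map (by fun_prop) (by fun_prop), Measure.map_map (by fun_prop) (by fun_prop)]
        at h2
      simpa [Function.comp_def] using h2
  refine ⟨P, inferInstance, hmarg, ae_all_iff.2 fun n => ?_⟩
  have h1 := hjoint n
  rw [hmarg, ← h n, compProd_map_condDistrib (by fun_prop)] at h1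
  have hms : MeasurableSet {p : V × V | p.1 = π p.2} :=
    measurableSet_eq_fun measurable_fst (by fun_prop)
  have h2 : ∀ᵐ p ∂P.map (fun x => (x n, x (n + 1))), p.1 = π p.2 := by
    rw [h1, ae_map_iff (by fun_prop) hms]
    simp
  rwa [ae_map_iff (by fun_prop) hms] at h2

end Tower

/-- Induction on the finite family of blocks: the remaining blocks generate a σ-algebra indexed by
their union, which is disjoint from the new block. -/
theorem iIndep_iSup_of_pairwise_disjoint {Ω ι κ : Type*} {mΩ : MeasurableSpace Ω} {P : Measure Ω}
    {m : ι → MeasurableSpace Ω} (hm : ∀ i, m i ≤ mΩ) (h : iIndep m P) {S : κ → Set ι}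
    (hS : Pairwise fun j k => Disjoint (S j) (S k)) :
    iIndep (fun j => ⨆ i ∈ S j, m i) P := by
  classical
  have := h.isProbabilityMeasure
  rw [iIndep_iff]
  intro s
  induction s using Finset.induction_on with
  | empty => intro f _; simp
  | insert j s hj ih =>
    intro f hf
    rw [Finset.set_biInter_insert, Finset.prod_insert hj, ← ih fun k hk => hf k (by simp [hk])]
    have hd : Disjoint (S j) (⋃ k ∈ s, S k) := by
      simp only [Set.disjoint_iUnion_right]
      exact fun k hk => hS fun e => hj (e ▸ hk)
    have hi := indep_iSup_of_disjoint hm h hd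
    refine (Indep_iff _ _ P).1 hi _ _ ?_ ?_
    · exact hf j (by simp)
    refine Finset.measurableSet_biInter _ fun k hk => ?_
    refine (?_ : (⨆ i ∈ S k, m i) ≤ _) _ (hf k (by simp [hk]))
    exact biSup_mono fun i hi => Set.mem_biUnion hk hi

theorem measurable_iSup_comap_sum {Ω : Type*} {ξ : ℕ → Ω → E d} {S : Set ℕ} {s : Finset ℕ}
    (hs : ∀ i ∈ s, i ∈ S) :
    Measurable[⨆ i ∈ S, (inferInstance : MeasurableSpace (E d)).comap (ξ i)]
      fun ω => ∑ i ∈ s, ξ i ω := by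
  refine Finset.measurable_fun_sum _ fun i hi => ?_
  refine Measurable.mono (comap_measurable (ξ i)) ?_ le_rfl
  exact le_biSup (fun i => (inferInstance : MeasurableSpace (E d)).comap (ξ i)) (hs i hi)

theorem iIndepFun_sum_Ico {Ω : Type*} {mΩ : MeasurableSpace Ω} {P : Measure Ω} {ξ : ℕ → Ω → E d}
    (hm : ∀ i, Measurable (ξ i)) (h : iIndepFun ξ P) {a : ℕ → ℕ} (ha : Monotone a) :
    iIndepFun (fun j ω => ∑ i ∈ Finset.Ico (a j) (a (j + 1)), ξ i ω) P := by
  have h1 := iIndep_iSup_of_pairwise_disjoint (fun i => (hm i).comap_le) h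
    (S := fun j => Set.Ico (a j) (a (j + 1))) ha.pairwise_disjoint_on_Ico_succ
  refine iIndep_of_iIndep_of_le h1 fun j => ?_
  exact (measurable_iSup_comap_sum (fun i hi => by simpa using hi)).comap_le

/-- Nested random walks: the increments of the `n`-th walk are independent with law `μ n`, and each
of them is the sum of two successive increments of the next walk. -/
theorem exists_nested_walks (μ : ℕ → Measure (E d)) [∀ n, IsProbabilityMeasure (μ n)]
    (h : ∀ n, μ (n + 1) ∗ μ (n + 1) = μ n) :
    ∃ (Ω : Type) (_ : MeasurableSpace Ω) (P : Measure Ω) (ξ : ℕ → ℕ → Ω → E d),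
      IsProbabilityMeasure P ∧ (∀ n i, Measurable (ξ n i)) ∧ (∀ n, iIndepFun (ξ n) P) ∧
      (∀ n i, P.map (ξ n i) = μ n) ∧
      ∀ᵐ ω ∂P, ∀ n i, ξ n i ω = ξ (n + 1) (2 * i) ω + ξ (n + 1) (2 * i + 1) ω := by
  let π : (ℕ → E d) → (ℕ → E d) := fun v i => v (2 * i) + v (2 * i + 1)
  have hπ : Measurable π := by fun_prop
  let Q : ℕ → Measure (ℕ → E d) := fun n => Measure.infinitePi fun _ => μ n
  -- Adding neighbours in pairs carries the product law of the finer increments to that of the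
  -- coarser ones: the pairs are disjoint blocks, and each pair sum has law `μ (n + 1) ∗ μ (n + 1)`.
  have hQ : ∀ n, (Q (n + 1)).map π = Q n := by
    intro n
    have hind : iIndepFun (fun (i : ℕ) (v : ℕ → E d) => v i) (Q (n + 1)) :=
      iIndepFun_infinitePi (X := fun _ x => x) (fun _ => measurable_id)
    have hmon : Monotone fun i : ℕ => 2 * i := fun i j hij => by dsimp only; omega
    have h1 := iIndepFun_sum_Ico (fun i => by fun_prop) hind hmon
    have h2 : (fun (j : ℕ) (v : ℕ → E d) => ∑ i ∈ Finset.Ico (2 * j) (2 * (j + 1)), v i) =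
        fun j v => v (2 * j) + v (2 * j + 1) := by
      ext1 j
      ext1 v
      rw [show 2 * (j + 1) = 2 * j + 1 + 1 by ring, Finset.sum_Ico_succ_top (by omega),
        Finset.sum_Ico_succ_top (by omega)]
      simp
    rw [h2] at h1
    have h3 := h1.map_fun_eq_infinitePi_map (fun i => by fun_prop)
    refine h3.trans (congrArg Measure.infinitePi ?_)
    ext1 j
    have h4 := (hind.indepFun (i := 2 * j) (j := 2 * j + 1) (by omega)).map_add_eq_map_conv_map
      (by fun_prop) (by fun_prop)
    refine h4.trans ?_
    change (Measure.infinitePi _).map _ ∗ (Measure.infinitePi _).map _ = _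
    rw [Measure.infinitePi_map_eval, Measure.infinitePi_map_eval, h]
  obtain ⟨P, hP, hmarg, hae⟩ := exists_measure_of_map_eq Q hπ hQ
  refine ⟨ℕ → ℕ → E d, inferInstance, P, fun n i ω => ω n i, hP, fun n i => by fun_prop,
    fun n => ?_, fun n i => ?_, ?_⟩
  · rw [iIndepFun_iff_map_fun_eq_infinitePi_map (fun i => by fun_prop)]
    refine (hmarg n).trans (congrArg Measure.infinitePi ?_)
    ext1 i
    have h1 : P.map (fun ω => ω n i) = (P.map fun ω => ω n).map fun v => v i := by
      rw [Measure.map_map (by fun_prop) (by fun_prop)]; rfl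
    rw [h1, hmarg]
    exact (Measure.infinitePi_map_eval (fun _ => μ n) i).symm
  · have h1 : P.map (fun ω => ω n i) = (P.map fun ω => ω n).map fun v => v i := by
      rw [Measure.map_map (by fun_prop) (by fun_prop)]; rfl
    rw [h1, hmarg]
    exact Measure.infinitePi_map_eval _ i
  · filter_upwards [hae] with ω hω n i
    exact congrFun (hω n) i

/-! ### Oscillations and exits of random walks -/

/-- Partial sums. -/
def walk (v : ℕ → E d) (k : ℕ) : E d := ∑ i ∈ Finset.range k, v i

theorem walk_sub_walk (v : ℕ → E d) {a b : ℕ} (h : a ≤ b) :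
    walk v b - walk v a = ∑ i ∈ Finset.Ico a b, v i :=
  (Finset.sum_Ico_eq_sub _ h).symm

theorem measurable_walk {Ω : Type*} {mΩ : MeasurableSpace Ω} {ξ : ℕ → Ω → E d}
    (hm : ∀ i, Measurable (ξ i)) (k : ℕ) : Measurable fun ω => walk (fun i => ξ i ω) k :=
  Finset.measurable_fun_sum _ fun i _ => hm i

/-- `S` has at least `p` disjoint oscillations of size more than `ε` along `D`, between `a` and
`b`. -/
def HasOsc {T : Type*} [Preorder T] (x : T → E d) (D : Set T) (ε : ℝ) : ℕ → T → T → Prop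
  | 0, _, _ => True
  | p + 1, a, b => ∃ s ∈ D, ∃ t ∈ D, a ≤ s ∧ s < t ∧ t ≤ b ∧ ε < ‖x t - x s‖ ∧ HasOsc x D ε p t b

/-- `j` is the first time after `a` at which `S` is further than `δ` from its position at `a`. -/
def FirstExit (S : ℕ → E d) (δ : ℝ) (a j : ℕ) : Prop :=
  δ < ‖S j - S a‖ ∧ ∀ i, a < i → i < j → ‖S i - S a‖ ≤ δ

/-- After time `a` and up to time `K`, the walk `S` leaves at least `p` times the ball of radius `δ`
around its position at the preceding exit time. -/
def HasExits (S : ℕ → E d) (δ : ℝ) (K : ℕ) : ℕ → ℕ → Prop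
  | 0, _ => True
  | p + 1, a => ∃ j, a < j ∧ j ≤ K ∧ FirstExit S δ a j ∧ HasExits S δ K p j

section Osc

variable {T : Type*} [Preorder T] {x : T → E d} {D : Set T} {ε : ℝ}

theorem HasOsc.mono {p : ℕ} {a a' b b' : T} (h : HasOsc x D ε p a b) (ha : a' ≤ a)
    (hb : b ≤ b') : HasOsc x D ε p a' b' := by
  induction p generalizing a a' with
  | zero => trivial
  | succ p ih =>
    obtain ⟨s, hs, t, ht, has, hst, htb, hε, h'⟩ := h
    exact ⟨s, hs, t, ht, ha.trans has, hst, htb.trans hb, hε, ih h' le_rfl⟩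

theorem HasOsc.mono_size {ε' : ℝ} {p : ℕ} {a b : T} (h : HasOsc x D ε p a b) (hε : ε' ≤ ε) :
    HasOsc x D ε' p a b := by
  induction p generalizing a with
  | zero => trivial
  | succ p ih =>
    obtain ⟨s, hs, t, ht, has, hst, htb, hlt, h'⟩ := h
    exact ⟨s, hs, t, ht, has, hst, htb, hε.trans_lt hlt, ih h'⟩

/-- `HasOsc` grows at its left end; this extends it on the right, as needed for left limits. -/
theorem HasOsc.append {p : ℕ} {a b c s t : T} (h : HasOsc x D ε p a b) (hab : a ≤ b) (hs : s ∈ D)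
    (ht : t ∈ D) (hbs : b ≤ s) (hst : s < t) (htc : t ≤ c) (hε : ε < ‖x t - x s‖) :
    HasOsc x D ε (p + 1) a c := by
  induction p generalizing a with
  | zero => exact ⟨s, hs, t, ht, hab.trans hbs, hst, htc, hε, trivial⟩
  | succ p ih =>
    obtain ⟨s', hs', t', ht', has, hst', htb, hε', h'⟩ := h
    exact ⟨s', hs', t', ht', has, hst', htb.trans (hbs.trans (hst.le.trans htc)), hε', ih h' htb⟩

end Osc

/-- Two points more than `2δ` apart cannot both lie in the `δ`-ball around `S a`, so the first exit
happens no later than the end of the first oscillation, and the other oscillations come after it. -/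
theorem HasOsc.hasExits {S : ℕ → E d} {δ : ℝ} (hδ : 0 ≤ δ) {K p a : ℕ}
    (h : HasOsc S Set.univ (2 * δ) p a K) : HasExits S δ K p a := by
  classical
  induction p generalizing a with
  | zero => trivial
  | succ p ih =>
    obtain ⟨s, -, t, -, has, hst, htb, hε, h'⟩ := h
    have hex : ∃ j, a < j ∧ j ≤ t ∧ δ < ‖S j - S a‖ := by
      by_contra! hcon
      have h1 : ‖S t - S a‖ ≤ δ := hcon t (by omega) le_rfl
      have h2 : ‖S s - S a‖ ≤ δ := by
        rcases has.eq_or_lt with rfl | hlt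
        · simpa using hδ
        · exact hcon s hlt hst.le
      have h3 : ‖S t - S s‖ ≤ ‖S t - S a‖ + ‖S s - S a‖ := by
        simpa using norm_sub_le (S t - S a) (S s - S a)
      linarith
    obtain ⟨h1, h2, h3⟩ := Nat.find_spec hex
    refine ⟨Nat.find hex, h1, h2.trans htb, ⟨h3, fun i hai hij => ?_⟩, ih (h'.mono h2 le_rfl)⟩
    by_contra! hcon
    exact Nat.find_min hex hij ⟨hai, (hij.le.trans h2), hcon⟩

section Exits

variable {Ω : Type*} {mΩ : MeasurableSpace Ω} {P : Measure Ω} {ξ : ℕ → Ω → E d}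

/-- Measurability is with respect to the increments in `[a, j)` only, which makes the exit at `j`
independent of the walk after `j`. -/
theorem measurableSet_firstExit {S : Set ℕ} {δ : ℝ} {a j : ℕ} (haj : a ≤ j)
    (hS : Set.Ico a j ⊆ S) :
    MeasurableSet[⨆ i ∈ S, (inferInstance : MeasurableSpace (E d)).comap (ξ i)]
      {ω | FirstExit (walk fun i => ξ i ω) δ a j} := by
  have hsub : ∀ i, a ≤ i → i ≤ j →
      Measurable[⨆ i ∈ S, (inferInstance : MeasurableSpace (E d)).comap (ξ i)]
        fun ω => ‖walk (fun i => ξ i ω) i - walk (fun i => ξ i ω) a‖ := by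
    intro i hai hij
    simp only [walk_sub_walk _ hai]
    refine measurable_norm.comp (measurable_iSup_comap_sum fun k hk => hS ?_)
    simp only [Finset.mem_Ico] at hk
    exact ⟨hk.1, hk.2.trans_le hij⟩
  have : {ω | FirstExit (walk fun i => ξ i ω) δ a j} =
      {ω | δ < ‖walk (fun i => ξ i ω) j - walk (fun i => ξ i ω) a‖} ∩
        ⋂ i ∈ Set.Ioo a j, {ω | ‖walk (fun i => ξ i ω) i - walk (fun i => ξ i ω) a‖ ≤ δ} := by
    ext ω
    simp [FirstExit]
  rw [this]
  refine MeasurableSet.inter (measurableSet_lt measurable_const (hsub j haj le_rfl)) ?_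
  refine MeasurableSet.biInter (Set.to_countable _) fun i hi => ?_
  exact measurableSet_le (hsub i hi.1.le hi.2.le) measurable_const

theorem measurableSet_hasExits (δ : ℝ) (K p a : ℕ) :
    MeasurableSet[⨆ i ∈ Set.Ici a, (inferInstance : MeasurableSpace (E d)).comap (ξ i)]
      {ω | HasExits (walk fun i => ξ i ω) δ K p a} := by
  induction p generalizing a with
  | zero => simp [HasExits]
  | succ p ih =>
    have : {ω | HasExits (walk fun i => ξ i ω) δ K (p + 1) a} = ⋃ j ∈ Set.Ioc a K,
        {ω | FirstExit (walk fun i => ξ i ω) δ a j} ∩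
          {ω | HasExits (walk fun i => ξ i ω) δ K p j} := by
      ext ω
      simp only [HasExits, Set.mem_ofPred_eq, Set.mem_iUnion, Set.mem_inter_iff, Set.mem_Ioc,
        exists_prop]
      exact exists_congr fun _ => by tauto
    rw [this]
    refine MeasurableSet.biUnion (Set.to_countable _) fun j hj => ?_
    refine MeasurableSet.inter (measurableSet_firstExit hj.1.le fun i hi => hi.1) ?_
    refine (?_ : (⨆ i ∈ Set.Ici j, (inferInstance : MeasurableSpace (E d)).comap (ξ i)) ≤ _) _
      (ih j)
    exact biSup_mono fun i hi => (hj.1.le.trans hi : a ≤ i)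

theorem iSup_comap_le (hm : ∀ i, Measurable (ξ i)) (S : Set ℕ) :
    (⨆ i ∈ S, (inferInstance : MeasurableSpace (E d)).comap (ξ i)) ≤ mΩ :=
  iSup₂_le fun i _ => (hm i).comap_le

theorem measureReal_inter_of_past_future (hm : ∀ i, Measurable (ξ i)) (hind : iIndepFun ξ P)
    {a j : ℕ} {A B : Set Ω}
    (hA : MeasurableSet[⨆ i ∈ Set.Ico a j, (inferInstance : MeasurableSpace (E d)).comap (ξ i)] A)
    (hB : MeasurableSet[⨆ i ∈ Set.Ici j, (inferInstance : MeasurableSpace (E d)).comap (ξ i)] B) :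
    P.real (A ∩ B) = P.real A * P.real B := by
  have hd : Disjoint (Set.Ico a j) (Set.Ici j) := by
    rw [Set.disjoint_left]
    intro i hi hj
    exact absurd hi.2 (not_lt.2 hj)
  have h := (Indep_iff _ _ P).1 (indep_iSup_of_disjoint (fun i => (hm i).comap_le) hind hd) A B hA hB
  simp [measureReal_def, h]

/-- Ottaviani's inequality, summed over the first exit time. -/
theorem sum_measureReal_firstExit_le (hm : ∀ i, Measurable (ξ i)) (hind : iIndepFun ξ P) {δ : ℝ}
    {a K : ℕ} (haK : a ≤ K)
    (hsmall : ∀ j, a ≤ j → j ≤ K →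
      P.real {ω | δ < ‖walk (fun i => ξ i ω) K - walk (fun i => ξ i ω) j‖} ≤ 1 / 3) :
    ∑ j ∈ Finset.Ioc a K, P.real {ω | FirstExit (walk fun i => ξ i ω) (2 * δ) a j} ≤ 1 / 2 := by
  have := hind.isProbabilityMeasure
  set F : ℕ → Set Ω := fun j => {ω | FirstExit (walk fun i => ξ i ω) (2 * δ) a j} with hF
  set B : ℕ → Set Ω := fun j =>
    {ω | δ < ‖walk (fun i => ξ i ω) K - walk (fun i => ξ i ω) j‖} with hB
  have hFm : ∀ j, a ≤ j → MeasurableSet (F j) := fun j hj =>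
    iSup_comap_le hm _ _ (measurableSet_firstExit hj subset_rfl)
  have hBm' : ∀ j, j ≤ K →
      MeasurableSet[⨆ i ∈ Set.Ici j, (inferInstance : MeasurableSpace (E d)).comap (ξ i)] (B j) := by
    intro j hj
    refine measurableSet_lt measurable_const (measurable_norm.comp ?_)
    simp only [walk_sub_walk _ hj]
    exact measurable_iSup_comap_sum fun k hk => (Finset.mem_Ico.1 hk).1
  have hBm : ∀ j, j ≤ K → MeasurableSet (B j) := fun j hj => iSup_comap_le hm _ _ (hBm' j hj)
  have hdisj : Set.PairwiseDisjoint (Finset.Ioc a K : Set ℕ) fun j => F j ∩ (B j)ᶜ := by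
    have haux : ∀ j k, a < j → j < k → Disjoint (F j ∩ (B j)ᶜ) (F k ∩ (B k)ᶜ) := by
      intro j k haj hjk
      rw [Set.disjoint_left]
      rintro ω ⟨h1, -⟩ ⟨h2, -⟩
      exact absurd h1.1 (not_lt.2 (h2.2 j haj hjk))
    intro j hj k hk hjk
    simp only [Finset.coe_Ioc, Set.mem_Ioc] at hj hk
    rcases lt_or_gt_of_ne hjk with h | h
    · exact haux j k hj.1 h
    · exact (haux k j hk.1 h).symm
  -- A walk that is more than `2δ` away at its exit and within `δ` of the exit position at time `K`
  -- is still more than `δ` away at time `K`.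
  have hsub : (⋃ j ∈ Finset.Ioc a K, F j ∩ (B j)ᶜ) ⊆ B a := by
    intro ω hω
    simp only [Set.mem_iUnion, Finset.mem_Ioc] at hω
    obtain ⟨j, -, h1, h2⟩ := hω
    simp only [hB, Set.mem_compl_iff, Set.mem_ofPred_eq, not_lt] at h2 ⊢
    have h3 := h1.1
    have h4 : ‖walk (fun i => ξ i ω) j - walk (fun i => ξ i ω) a‖ ≤
        ‖walk (fun i => ξ i ω) K - walk (fun i => ξ i ω) a‖ +
          ‖walk (fun i => ξ i ω) K - walk (fun i => ξ i ω) j‖ := by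
      simpa using norm_sub_le (walk (fun i => ξ i ω) K - walk (fun i => ξ i ω) a)
        (walk (fun i => ξ i ω) K - walk (fun i => ξ i ω) j)
    linarith
  have hle : ∑ j ∈ Finset.Ioc a K, P.real (F j ∩ (B j)ᶜ) ≤ 1 / 3 := by
    rw [← measureReal_biUnion_finset hdisj fun j hj => by
      rw [Finset.mem_Ioc] at hj
      exact (hFm j hj.1.le).inter (hBm j hj.2).compl]
    exact (measureReal_mono hsub).trans (hsmall a le_rfl haK)
  -- By independence of the later displacement, which stays within `δ` with probability at least `2
  -- / 3`. With `hle`, the sum is at most `(1 / 3) / (2 / 3) = 1 / 2`.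
  have hterm : ∀ j ∈ Finset.Ioc a K, P.real (F j) * (2 / 3) ≤ P.real (F j ∩ (B j)ᶜ) := by
    intro j hj
    rw [Finset.mem_Ioc] at hj
    rw [measureReal_inter_of_past_future hm hind (measurableSet_firstExit hj.1.le subset_rfl)
      (hBm' j hj.2).compl]
    refine mul_le_mul_of_nonneg_left ?_ measureReal_nonneg
    have := hsmall j hj.1.le hj.2
    rw [probReal_compl_eq_one_sub (hBm j hj.2)]
    linarith
  have := (Finset.sum_le_sum hterm).trans hle
  rw [← Finset.sum_mul] at this
  linarith

/-- Markov property at the first exit: after an exit at `j` the future is independent, costing `(1 /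
2) ^ p`, and the exit probabilities sum to at most `1 / 2`. -/
theorem measureReal_hasExits_le (hm : ∀ i, Measurable (ξ i)) (hind : iIndepFun ξ P) {δ : ℝ}
    {a₀ K : ℕ} (hsmall : ∀ j k, a₀ ≤ j → j ≤ k → k ≤ K →
      P.real {ω | δ < ‖walk (fun i => ξ i ω) k - walk (fun i => ξ i ω) j‖} ≤ 1 / 3)
    (p a : ℕ) (ha : a₀ ≤ a) (haK : a ≤ K) :
    P.real {ω | HasExits (walk fun i => ξ i ω) (2 * δ) K p a} ≤ (1 / 2) ^ p := by
  have := hind.isProbabilityMeasure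
  induction p generalizing a with
  | zero => simp [measureReal_le_one]
  | succ p ih =>
    have hset : {ω | HasExits (walk fun i => ξ i ω) (2 * δ) K (p + 1) a} =
        ⋃ j ∈ Finset.Ioc a K, {ω | FirstExit (walk fun i => ξ i ω) (2 * δ) a j} ∩
          {ω | HasExits (walk fun i => ξ i ω) (2 * δ) K p j} := by
      ext ω
      simp only [HasExits, Set.mem_ofPred_eq, Set.mem_iUnion, Set.mem_inter_iff, Finset.mem_Ioc,
        exists_prop]
      exact exists_congr fun _ => by tauto
    rw [hset]
    calc P.real (⋃ j ∈ Finset.Ioc a K, {ω | FirstExit (walk fun i => ξ i ω) (2 * δ) a j} ∩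
          {ω | HasExits (walk fun i => ξ i ω) (2 * δ) K p j})
        ≤ ∑ j ∈ Finset.Ioc a K, P.real ({ω | FirstExit (walk fun i => ξ i ω) (2 * δ) a j} ∩
          {ω | HasExits (walk fun i => ξ i ω) (2 * δ) K p j}) := measureReal_biUnion_finset_le _ _
      _ ≤ ∑ j ∈ Finset.Ioc a K, P.real {ω | FirstExit (walk fun i => ξ i ω) (2 * δ) a j} *
          (1 / 2) ^ p := by
        refine Finset.sum_le_sum fun j hj => ?_
        rw [Finset.mem_Ioc] at hj
        rw [measureReal_inter_of_past_future hm hind (measurableSet_firstExit hj.1.le subset_rfl)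
          (measurableSet_hasExits _ _ _ _)]
        exact mul_le_mul_of_nonneg_left (ih j (ha.trans hj.1.le) hj.2) measureReal_nonneg
      _ ≤ (1 / 2) ^ (p + 1) := by
        rw [← Finset.sum_mul, pow_succ, mul_comm]
        refine mul_le_mul_of_nonneg_left ?_ (by positivity)
        exact sum_measureReal_firstExit_le hm hind haK fun j hj hjK =>
          hsmall j K (ha.trans hj) hjK le_rfl

end Exits

theorem measure_eventually_le {Ω : Type*} {mΩ : MeasurableSpace Ω} (P : Measure Ω)
    (A : ℕ → Set Ω) {c : ENNReal} (h : ∀ᶠ n in atTop, P (A n) ≤ c) :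
    P {ω | ∀ᶠ n in atTop, ω ∈ A n} ≤ c := by
  have hset : {ω | ∀ᶠ n in atTop, ω ∈ A n} = ⋃ N : ℕ, ⋂ n ≥ N, A n := by
    ext ω
    simp [eventually_atTop]
  have hmono : Monotone fun N : ℕ => ⋂ n ≥ N, A n := by
    intro N M hNM
    exact Set.iInter₂_mono' fun n hn => ⟨n, le_trans hNM hn, le_rfl⟩
  rw [hset, hmono.measure_iUnion]
  obtain ⟨N₀, hN₀⟩ := eventually_atTop.1 h
  refine iSup_le fun N => ?_
  exact (measure_mono (Set.iInter₂_subset (max N N₀) (le_max_left _ _))).trans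
    (hN₀ _ (le_max_right _ _))

/-- Otherwise laws with exponents `s_j ψ`, `s_j → 0`, would violate the bound; by Lévy's continuity
theorem they converge weakly to the Dirac mass at `0`, which contradicts the portmanteau theorem for
`{δ ≤ ‖x‖}`. -/
theorem exists_measureReal_norm_gt_le (ψ : E d → ℂ) {δ : ℝ} (hδ : 0 < δ) :
    ∃ η : ℝ, 0 < η ∧ ∀ (κ : Measure (E d)) [IsProbabilityMeasure κ] (s : ℝ), 0 ≤ s → s ≤ η →
      (∀ y, charFun κ y = Complex.exp (s * ψ y)) → κ.real {x | δ < ‖x‖} ≤ 1 / 3 := by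
  by_contra! hcon
  have hpos : ∀ j : ℕ, (0 : ℝ) < 1 / (j + 1) := fun j => by positivity
  choose κ hκ s hs0 hs1 hchar hlt using fun j : ℕ => hcon _ (hpos j)
  have hs : Tendsto s atTop (𝓝 0) :=
    squeeze_zero hs0 hs1 tendsto_one_div_add_atTop_nhds_zero_nat
  let K : ℕ → ProbabilityMeasure (E d) := fun j => ⟨κ j, hκ j⟩
  let K₀ : ProbabilityMeasure (E d) := ⟨Measure.dirac 0, inferInstance⟩
  have hK : Tendsto K atTop (𝓝 K₀) := by
    refine ProbabilityMeasure.tendsto_iff_tendsto_charFun.2 fun y => ?_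
    have h1 : Tendsto (fun j => Complex.exp (s j * ψ y)) atTop (𝓝 (Complex.exp ((0 : ℝ) * ψ y))) :=
      (Complex.continuous_exp.tendsto _).comp
        (((Complex.continuous_ofReal.tendsto _).comp hs).mul_const _)
    have h2 : charFun (K₀ : Measure (E d)) y = Complex.exp ((0 : ℝ) * ψ y) := by
      simp [K₀, charFun_dirac]
    rw [h2]
    exact h1.congr fun j => (hchar j y).symm
  have hclosed : IsClosed {x : E d | δ ≤ ‖x‖} := isClosed_le continuous_const continuous_norm
  have h3 := ProbabilityMeasure.limsup_measure_closed_le_of_tendsto hK hclosed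
  have h4 : (K₀ : Measure (E d)) {x : E d | δ ≤ ‖x‖} = 0 := by
    simp [K₀, hδ]
  rw [h4] at h3
  have h5 : ENNReal.ofReal (1 / 3) ≤
      limsup (fun j => (K j : Measure (E d)) {x : E d | δ ≤ ‖x‖}) atTop := by
    refine le_limsup_of_frequently_le (Frequently.of_forall fun j => ?_) (by isBoundedDefault)
    have := hκ j
    refine (ENNReal.ofReal_le_iff_le_toReal (measure_ne_top _ _)).2 ?_
    exact (hlt j).le.trans (measureReal_mono (μ := κ j) fun x hx => by
      simp only [Set.mem_ofPred_eq] at hx ⊢; exact hx.le)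
  have h6 := h5.trans h3
  simp at h6

/-! ### One-sided limits along the dyadics -/

/-- If the Cauchy criterion fails, every right neighbourhood of `t` contains an oscillation.
Choosing each one closer to `t` than those before gives arbitrarily many. -/
theorem exists_tendsto_nhdsGT_of_not_hasOsc {x : ℝ≥0 → E d} {D : Set ℝ≥0} {t : ℝ≥0}
    (hne : (𝓝[D ∩ Set.Ioi t] t).NeBot)
    (h : ∀ ε > 0, ∃ u > t, ∃ p, ¬ HasOsc x D ε p t u) :
    ∃ l, Tendsto x (𝓝[D ∩ Set.Ioi t] t) (𝓝 l) := by
  refine cauchy_map_iff_exists_tendsto.1 (Metric.cauchy_iff.2 ⟨hne.map x, fun ε hε => ?_⟩)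
  by_contra! hcon
  obtain ⟨u, hu, p, hp⟩ := h (ε / 2) (half_pos hε)
  have key : ∀ v > t, ∃ q ∈ D, ∃ q' ∈ D, t < q ∧ q < q' ∧ q' < v ∧ ε / 2 < ‖x q' - x q‖ := by
    intro v hv
    have hmem : D ∩ Set.Ioo t v ∈ 𝓝[D ∩ Set.Ioi t] t := by
      have := inter_mem_nhdsWithin (D ∩ Set.Ioi t) (Iio_mem_nhds hv)
      refine mem_of_superset this fun s hs => ⟨hs.1.1, hs.1.2, hs.2⟩
    obtain ⟨_, ⟨q, hq, rfl⟩, _, ⟨q', hq', rfl⟩, hd⟩ := hcon _ (image_mem_map hmem)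
    rcases lt_trichotomy q q' with hlt | rfl | hlt
    · refine ⟨q, hq.1, q', hq'.1, hq.2.1, hlt, hq'.2.2, ?_⟩
      rw [← dist_eq_norm, dist_comm]; linarith
    · simp at hd; linarith
    · refine ⟨q', hq'.1, q, hq.1, hq'.2.1, hlt, hq.2.2, ?_⟩
      rw [← dist_eq_norm]; linarith
  have hall : ∀ p, ∃ s > t, s ≤ u ∧ HasOsc x D (ε / 2) p s u := by
    intro p
    induction p with
    | zero => exact ⟨u, hu, le_rfl, trivial⟩
    | succ p ih =>
      obtain ⟨s, hs, hsu, hosc⟩ := ih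
      obtain ⟨q, hq, q', hq', h1, h2, h3, h4⟩ := key s hs
      exact ⟨q, h1, (h2.trans h3).le.trans hsu, q, hq, q', hq', le_rfl, h2, h3.le.trans hsu, h4,
        hosc.mono h3.le le_rfl⟩
  obtain ⟨s, hs, -, hosc⟩ := hall p
  exact hp (hosc.mono hs.le le_rfl)

theorem exists_tendsto_nhdsLT_of_not_hasOsc {x : ℝ≥0 → E d} {D : Set ℝ≥0} {t : ℝ≥0}
    (hne : (𝓝[D ∩ Set.Iio t] t).NeBot)
    (h : ∀ ε > 0, ∃ u < t, ∃ p, ¬ HasOsc x D ε p u t) :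
    ∃ l, Tendsto x (𝓝[D ∩ Set.Iio t] t) (𝓝 l) := by
  refine cauchy_map_iff_exists_tendsto.1 (Metric.cauchy_iff.2 ⟨hne.map x, fun ε hε => ?_⟩)
  by_contra! hcon
  obtain ⟨u, hu, p, hp⟩ := h (ε / 2) (half_pos hε)
  have key : ∀ v < t, ∃ q ∈ D, ∃ q' ∈ D, v < q ∧ q < q' ∧ q' < t ∧ ε / 2 < ‖x q' - x q‖ := by
    intro v hv
    have hmem : D ∩ Set.Ioo v t ∈ 𝓝[D ∩ Set.Iio t] t := by
      have := inter_mem_nhdsWithin (D ∩ Set.Iio t) (Ioi_mem_nhds hv)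
      refine mem_of_superset this fun s hs => ⟨hs.1.1, hs.2, hs.1.2⟩
    obtain ⟨_, ⟨q, hq, rfl⟩, _, ⟨q', hq', rfl⟩, hd⟩ := hcon _ (image_mem_map hmem)
    rcases lt_trichotomy q q' with hlt | rfl | hlt
    · refine ⟨q, hq.1, q', hq'.1, hq.2.1, hlt, hq'.2.2, ?_⟩
      rw [← dist_eq_norm, dist_comm]; linarith
    · simp at hd; linarith
    · refine ⟨q', hq'.1, q, hq.1, hq'.2.1, hlt, hq.2.2, ?_⟩
      rw [← dist_eq_norm]; linarith
  have hall : ∀ p, ∃ s < t, u ≤ s ∧ HasOsc x D (ε / 2) p u s := by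
    intro p
    induction p with
    | zero => exact ⟨u, hu, le_rfl, trivial⟩
    | succ p ih =>
      obtain ⟨s, hs, hsu, hosc⟩ := ih
      obtain ⟨q, hq, q', hq', h1, h2, h3, h4⟩ := key s hs
      exact ⟨q', h3, hsu.trans (h1.trans h2).le, hosc.append hsu hq hq' h1.le h2 le_rfl h4⟩
  obtain ⟨s, hs, -, hosc⟩ := hall p
  exact hp (hosc.mono le_rfl hs.le)

/-- Near `s` the value `y s` is a limit of values of `x`, so a closed set containing these also
contains `y s`. -/
theorem tendsto_nhdsGT_of_forall_tendsto {x y : ℝ≥0 → E d} {D : Set ℝ≥0}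
    (hne : ∀ t, (𝓝[D ∩ Set.Ioi t] t).NeBot)
    (h : ∀ t, Tendsto x (𝓝[D ∩ Set.Ioi t] t) (𝓝 (y t))) (t : ℝ≥0) :
    Tendsto y (𝓝[>] t) (𝓝 (y t)) := by
  rw [(closed_nhds_basis (y t)).tendsto_right_iff]
  rintro C ⟨hC, hCc⟩
  have h1 := h t hC
  rw [mem_map, mem_nhdsWithin] at h1
  obtain ⟨O, hO, htO, hsub⟩ := h1
  filter_upwards [mem_nhdsWithin_of_mem_nhds (hO.mem_nhds htO), self_mem_nhdsWithin] with s hs hts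
  have := hne s
  refine hCc.mem_of_tendsto (h s) ?_
  filter_upwards [mem_nhdsWithin_of_mem_nhds (hO.mem_nhds hs), self_mem_nhdsWithin] with q hq hq'
  exact hsub ⟨hq, hq'.1, Set.mem_Ioi.2 (lt_trans (Set.mem_Ioi.1 hts) (Set.mem_Ioi.1 hq'.2))⟩

theorem tendsto_nhdsLT_of_forall_tendsto {x y : ℝ≥0 → E d} {D : Set ℝ≥0}
    (hne : ∀ t, (𝓝[D ∩ Set.Ioi t] t).NeBot)
    (h : ∀ t, Tendsto x (𝓝[D ∩ Set.Ioi t] t) (𝓝 (y t))) {t : ℝ≥0} {l : E d}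
    (hl : Tendsto x (𝓝[D ∩ Set.Iio t] t) (𝓝 l)) : Tendsto y (𝓝[<] t) (𝓝 l) := by
  rw [(closed_nhds_basis l).tendsto_right_iff]
  rintro C ⟨hC, hCc⟩
  have h1 := hl hC
  rw [mem_map, mem_nhdsWithin] at h1
  obtain ⟨O, hO, htO, hsub⟩ := h1
  filter_upwards [mem_nhdsWithin_of_mem_nhds (hO.mem_nhds htO), self_mem_nhdsWithin] with s hs hts
  have := hne s
  refine hCc.mem_of_tendsto (h s) ?_
  filter_upwards [mem_nhdsWithin_of_mem_nhds (hO.mem_nhds hs),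
    mem_nhdsWithin_of_mem_nhds (Iio_mem_nhds hts), self_mem_nhdsWithin] with q hq hqt hq'
  exact hsub ⟨hq, hq'.1, hqt⟩

/-- The dyadic rational numbers in `[0, ∞)`. -/
def dyadics : Set ℝ≥0 := {t | ∃ n k : ℕ, t = k / 2 ^ n}

theorem dyadic_mem (n k : ℕ) : (k / 2 ^ n : ℝ≥0) ∈ dyadics := ⟨n, k, rfl⟩

/-- The `+ 1` keeps the approximations strictly to the right of `t` even for dyadic `t`, so walks
evaluated there converge to the right limit. -/
theorem tendsto_succ_floor_dyadic (t : ℝ≥0) :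
    Tendsto (fun n : ℕ => ((⌊2 ^ n * t⌋₊ + 1 : ℕ) / 2 ^ n : ℝ≥0)) atTop
      (𝓝[dyadics ∩ Set.Ioi t] t) := by
  have hlow : ∀ n : ℕ, t < ((⌊2 ^ n * t⌋₊ + 1 : ℕ) / 2 ^ n : ℝ≥0) := by
    intro n
    rw [lt_div_iff₀ (by positivity), mul_comm]
    exact_mod_cast Nat.lt_floor_add_one (2 ^ n * t)
  have hup : ∀ n : ℕ, ((⌊2 ^ n * t⌋₊ + 1 : ℕ) / 2 ^ n : ℝ≥0) ≤ t + (1 / 2) ^ n := by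
    intro n
    rw [div_le_iff₀ (by positivity), add_mul, ← mul_pow]
    have := Nat.floor_le (zero_le : 0 ≤ 2 ^ n * t)
    push_cast
    rw [mul_comm t]
    simpa using this
  refine tendsto_nhdsWithin_iff.2 ⟨?_, Eventually.of_forall fun n => ⟨dyadic_mem _ _, hlow n⟩⟩
  refine tendsto_of_tendsto_of_tendsto_of_le_of_le tendsto_const_nhds ?_ (fun n => (hlow n).le) hup
  have : Tendsto (fun n : ℕ => (1 / 2 : ℝ≥0) ^ n) atTop (𝓝 0) :=
    tendsto_pow_atTop_nhds_zero_of_lt_one zero_le (by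
      rw [← NNReal.coe_lt_coe]; push_cast; norm_num)
  simpa using this.const_add t

instance neBot_nhdsGT_dyadics (t : ℝ≥0) : (𝓝[dyadics ∩ Set.Ioi t] t).NeBot :=
  (tendsto_succ_floor_dyadic t).neBot

theorem dense_dyadics : Dense dyadics := by
  refine dense_of_exists_between fun a b hab => ?_
  have h := tendsto_nhdsWithin_iff.1 (tendsto_succ_floor_dyadic a)
  obtain ⟨n, hn, hn'⟩ := ((h.1.eventually (Iio_mem_nhds hab)).and h.2).exists
  exact ⟨_, hn'.1, hn'.2, hn⟩

theorem neBot_nhdsLT_dyadics {t : ℝ≥0} (ht : 0 < t) : (𝓝[dyadics ∩ Set.Iio t] t).NeBot := by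
  rw [← mem_closure_iff_nhdsWithin_neBot, Set.inter_comm]
  refine closure_minimal (dense_dyadics.open_subset_closure_inter isOpen_Iio) isClosed_closure ?_
  rw [closure_Iio' (Set.nonempty_of_mem (Set.mem_Iio.2 ht))]
  exact Set.mem_Iic.2 le_rfl

/-- The value at dyadic times of the path which is traced by nested walks. -/
noncomputable def dyadicPath (S : ℕ → ℕ → E d) (t : ℝ≥0) : E d :=
  limUnder atTop fun n => S n ⌊2 ^ n * t⌋₊

section DyadicPath

variable {S : ℕ → ℕ → E d}

theorem eventually_dyadicPath_eq (hS : ∀ n k, S (n + 1) (2 * k) = S n k) {t : ℝ≥0}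
    (ht : t ∈ dyadics) :
    ∀ᶠ n in atTop, 2 ^ n * t = (⌊2 ^ n * t⌋₊ : ℕ) ∧ dyadicPath S t = S n ⌊2 ^ n * t⌋₊ := by
  obtain ⟨n, k, rfl⟩ := ht
  have hfl : ∀ m, (2 ^ (n + m) * (k / 2 ^ n) : ℝ≥0) = (2 ^ m * k : ℕ) := by
    intro m
    push_cast
    field_simp
    ring
  have hSm : ∀ m, S (n + m) (2 ^ m * k) = S n k := by
    intro m
    induction m with
    | zero => simp
    | succ m ih => rw [← ih, ← hS (n + m), ← add_assoc, pow_succ]; congr 1; ring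
  have hval : ∀ m, n ≤ m → (2 ^ m * (k / 2 ^ n) : ℝ≥0) = (⌊(2 ^ m * (k / 2 ^ n) : ℝ≥0)⌋₊ : ℕ) ∧
      S m ⌊(2 ^ m * (k / 2 ^ n) : ℝ≥0)⌋₊ = S n k := by
    intro m hm
    obtain ⟨j, rfl⟩ := Nat.exists_eq_add_of_le hm
    rw [hfl, Nat.floor_natCast]
    exact ⟨rfl, hSm j⟩
  have hlim : dyadicPath S (k / 2 ^ n) = S n k := by
    refine Tendsto.limUnder_eq (tendsto_const_nhds.congr' ?_)
    filter_upwards [eventually_ge_atTop n] with m hm using (hval m hm).2.symm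
  filter_upwards [eventually_ge_atTop n] with m hm
  exact ⟨(hval m hm).1, hlim.trans (hval m hm).2.symm⟩

theorem dyadicPath_div (hS : ∀ n k, S (n + 1) (2 * k) = S n k) (n k : ℕ) :
    dyadicPath S (k / 2 ^ n) = S n k := by
  have hSm : ∀ m, S (n + m) (2 ^ m * k) = S n k := by
    intro m
    induction m with
    | zero => simp
    | succ m ih => rw [← ih, ← hS (n + m), ← add_assoc, pow_succ]; congr 1; ring
  obtain ⟨m, ⟨h1, h2⟩, hm⟩ :=
    ((eventually_dyadicPath_eq hS (dyadic_mem n k)).and (eventually_ge_atTop n)).exists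
  obtain ⟨j, rfl⟩ := Nat.exists_eq_add_of_le hm
  have : (2 ^ (n + j) * (k / 2 ^ n) : ℝ≥0) = (2 ^ j * k : ℕ) := by
    push_cast
    field_simp
    ring
  rw [h2, this, Nat.floor_natCast, hSm]

/-- Finitely many dyadic times are all grid points from some level on, where path and walk agree. -/
theorem HasOsc.eventually_of_dyadicPath (hS : ∀ n k, S (n + 1) (2 * k) = S n k) {ε : ℝ} {p : ℕ}
    {a b : ℝ≥0} (h : HasOsc (dyadicPath S) dyadics ε p a b) :
    ∀ᶠ n in atTop, HasOsc (S n) Set.univ ε p ⌊2 ^ n * a⌋₊ ⌊2 ^ n * b⌋₊ := by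
  induction p generalizing a with
  | zero => exact Eventually.of_forall fun n => trivial
  | succ p ih =>
    obtain ⟨s, hs, t, ht, has, hst, htb, hε, h'⟩ := h
    filter_upwards [eventually_dyadicPath_eq hS hs, eventually_dyadicPath_eq hS ht, ih h'] with n
      ⟨h1, h2⟩ ⟨h3, h4⟩ h5
    refine ⟨⌊2 ^ n * s⌋₊, trivial, ⌊2 ^ n * t⌋₊, trivial, Nat.floor_mono (by gcongr), ?_, Nat.floor_mono (by gcongr),
      ?_, h5⟩
    · rw [← Nat.cast_lt (α := ℝ≥0), ← h1, ← h3]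
      gcongr
    · rwa [← h2, ← h4]

theorem tendsto_walk_of_tendsto_dyadicPath (hS : ∀ n k, S (n + 1) (2 * k) = S n k) {t : ℝ≥0}
    {l : E d} (h : Tendsto (dyadicPath S) (𝓝[dyadics ∩ Set.Ioi t] t) (𝓝 l)) :
    Tendsto (fun n => S n (⌊2 ^ n * t⌋₊ + 1)) atTop (𝓝 l) := by
  refine (h.comp (tendsto_succ_floor_dyadic t)).congr fun n => ?_
  exact dyadicPath_div hS n _

/-- Nested walks whose oscillations over short time intervals are finite in number trace a path
that has right and left limits everywhere along the dyadic rationals. -/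
theorem exists_cadlag_of_not_hasOsc (hS : ∀ n k, S (n + 1) (2 * k) = S n k)
    (h : ∀ ε > 0, ∃ l : ℕ, ∀ i : ℕ, ∃ p,
      ¬ HasOsc (dyadicPath S) dyadics ε p (i / 2 ^ l) ((i + 1 : ℕ) / 2 ^ l)) :
    ∃ y : ℝ≥0 → E d, (∀ t, Tendsto (fun n => S n (⌊2 ^ n * t⌋₊ + 1)) atTop (𝓝 (y t))) ∧
      (∀ t, Tendsto y (𝓝[>] t) (𝓝 (y t))) ∧ ∀ t, ∃ l, Tendsto y (𝓝[<] t) (𝓝 l) := by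
  have hR : ∀ t, ∃ l, Tendsto (dyadicPath S) (𝓝[dyadics ∩ Set.Ioi t] t) (𝓝 l) := by
    intro t
    refine exists_tendsto_nhdsGT_of_not_hasOsc inferInstance fun ε hε => ?_
    obtain ⟨l, hl⟩ := h ε hε
    obtain ⟨p, hp⟩ := hl ⌊2 ^ l * t⌋₊
    refine ⟨(⌊2 ^ l * t⌋₊ + 1 : ℕ) / 2 ^ l, ?_, p, fun hosc => hp (hosc.mono ?_ le_rfl)⟩
    · rw [gt_iff_lt, lt_div_iff₀ (by positivity), mul_comm]
      exact_mod_cast Nat.lt_floor_add_one (2 ^ l * t)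
    · rw [div_le_iff₀ (by positivity), mul_comm t]
      exact Nat.floor_le zero_le
  have hL : ∀ t > 0, ∃ l, Tendsto (dyadicPath S) (𝓝[dyadics ∩ Set.Iio t] t) (𝓝 l) := by
    intro t ht
    refine exists_tendsto_nhdsLT_of_not_hasOsc (neBot_nhdsLT_dyadics ht) fun ε hε => ?_
    obtain ⟨l, hl⟩ := h ε hε
    -- The ceiling places `t` in `(i / 2 ^ l, (i + 1) / 2 ^ l]`, so the interval contains times
    -- before `t` even when `t` is a grid point.
    have hpos : 0 < ⌈2 ^ l * t⌉₊ := Nat.ceil_pos.2 (by positivity)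
    obtain ⟨i, hi⟩ : ∃ i, ⌈2 ^ l * t⌉₊ = i + 1 := ⟨⌈2 ^ l * t⌉₊ - 1, by omega⟩
    obtain ⟨p, hp⟩ := hl i
    refine ⟨i / 2 ^ l, ?_, p, fun hosc => hp (hosc.mono le_rfl ?_)⟩
    · rw [div_lt_iff₀ (by positivity), mul_comm t]
      exact Nat.lt_ceil.1 (by omega)
    · rw [le_div_iff₀ (by positivity), mul_comm t, ← hi]
      exact Nat.le_ceil _
  choose y hy using hR
  refine ⟨y, fun t => tendsto_walk_of_tendsto_dyadicPath hS (hy t),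
    tendsto_nhdsGT_of_forall_tendsto (fun t => inferInstance) hy, fun t => ?_⟩
  rcases eq_or_ne t 0 with rfl | ht
  -- `𝓝[<] 0` is trivial in `ℝ≥0`, so any value serves as left limit.
  · exact ⟨0, by simp⟩
  · obtain ⟨l, hl⟩ := hL t (pos_iff_ne_zero.2 ht)
    exact ⟨l, tendsto_nhdsLT_of_forall_tendsto (fun t => inferInstance) hy hl⟩

end DyadicPath

/-! ### Existence of Lévy processes -/

theorem tendsto_charFun_map_of_tendsto_ae {F Ω : Type*} [NormedAddCommGroup F]
    [InnerProductSpace ℝ F] [SecondCountableTopology F] [MeasurableSpace F] [BorelSpace F]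
    {mΩ : MeasurableSpace Ω} {P : Measure Ω} [IsProbabilityMeasure P] {Z : ℕ → Ω → F} {Z₀ : Ω → F}
    (hZ : ∀ n, AEMeasurable (Z n) P) (hZ₀ : AEMeasurable Z₀ P)
    (h : ∀ᵐ ω ∂P, Tendsto (fun n => Z n ω) atTop (𝓝 (Z₀ ω))) (y : F) :
    Tendsto (fun n => charFun (P.map (Z n)) y) atTop (𝓝 (charFun (P.map Z₀) y)) := by
  have hmap : ∀ Z : Ω → F, AEMeasurable Z P → charFun (P.map Z) y =
      ∫ ω, Complex.exp (inner ℝ (Z ω) y * Complex.I) ∂P := by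
    intro Z hZ
    rw [charFun_apply, integral_map hZ (by fun_prop)]
  simp_rw [fun n => hmap _ (hZ n), hmap _ hZ₀]
  refine tendsto_integral_of_dominated_convergence (fun _ => 1) (fun n => ?_)
    (integrable_const _) (fun n => ae_of_all _ fun ω => ?_) ?_
  · have := hZ n
    fun_prop
  · rw [Complex.norm_exp_ofReal_mul_I]
  · filter_upwards [h] with ω hω
    exact ((by fun_prop : Continuous fun x : F => Complex.exp (inner ℝ x y * Complex.I)).tendsto
      _).comp hω

/-- Independence is the factorization of the joint characteristic function, which passes to almost
sure limits. -/
theorem iIndepFun_of_tendsto_ae {ι Ω : Type*} [Fintype ι] {mΩ : MeasurableSpace Ω} {P : Measure Ω}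
    [IsProbabilityMeasure P] {X : ℕ → ι → Ω → E d} {X₀ : ι → Ω → E d}
    (hX : ∀ n i, AEMeasurable (X n i) P) (hX₀ : ∀ i, AEMeasurable (X₀ i) P)
    (hind : ∀ n, iIndepFun (X n) P)
    (h : ∀ i, ∀ᵐ ω ∂P, Tendsto (fun n => X n i ω) atTop (𝓝 (X₀ i ω))) : iIndepFun X₀ P := by
  rw [iIndepFun_iff_charFun_pi hX₀]
  intro t
  have h1 := tendsto_charFun_map_of_tendsto_ae (P := P)
    (Z := fun n ω => WithLp.toLp 2 (X n · ω)) (Z₀ := fun ω => WithLp.toLp 2 (X₀ · ω))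
    (fun n => by have := hX n; fun_prop) (by fun_prop) (by
      filter_upwards [ae_all_iff.2 h] with ω hω
      exact ((PiLp.continuous_toLp 2 _).tendsto _).comp (tendsto_pi_nhds.2 hω)) t
  have h2 : Tendsto (fun n => ∏ i, charFun (P.map (X n i)) (t i)) atTop
      (𝓝 (∏ i, charFun (P.map (X₀ i)) (t i))) :=
    tendsto_finsetProd _ fun i _ => tendsto_charFun_map_of_tendsto_ae (fun n => hX n i) (hX₀ i)
      (h i) (t i)
  refine tendsto_nhds_unique h1 (h2.congr fun n => ?_)
  exact ((iIndepFun_iff_charFun_pi (hX n)).1 (hind n) t).symm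

section NestedWalks

variable {Ω : Type*} {mΩ : MeasurableSpace Ω} {P : Measure Ω}
  {ξ : ℕ → ℕ → Ω → E d} {ψ : E d → ℂ}

theorem charFun_map_walk_sub_walk {ζ : ℕ → Ω → E d} {χ : E d → ℂ} (hm : ∀ i, Measurable (ζ i))
    (hind : iIndepFun ζ P) (hlaw : ∀ i y, charFun (P.map (ζ i)) y = Complex.exp (χ y)) {a b : ℕ}
    (hab : a ≤ b) (y : E d) :
    charFun (P.map fun ω => walk (fun i => ζ i ω) b - walk (fun i => ζ i ω) a) y =
      Complex.exp ((b - a : ℝ) * χ y) := by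
  simp only [walk_sub_walk _ hab]
  rw [(hind.restrict _).charFun_map_fun_finsetSum_eq_prod (fun i _ => (hm i).aemeasurable),
    Finset.prod_apply]
  simp only [hlaw, Finset.prod_const, Nat.card_Ico]
  rw [← Complex.exp_nat_mul]
  push_cast [hab]
  rfl

/-- With `2 ^ (-l) < η`, every increment of the walks within a cell of length `2 ^ (-l)` is small in
probability, so `p` exits have probability at most `2 ^ (-p)`, uniformly in the level. Of the two
factors `2`, one is lost in Ottaviani's inequality, the other in passing from oscillations to exits.
-/
theorem exists_ae_exists_not_hasOsc [IsProbabilityMeasure P]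
    (hm : ∀ n i, Measurable (ξ n i)) (hind : ∀ n, iIndepFun (ξ n) P)
    (hlaw : ∀ n i y, charFun (P.map (ξ n i)) y = Complex.exp (ψ y / 2 ^ n))
    (hS : ∀ᵐ ω ∂P, ∀ n k, walk (fun i => ξ (n + 1) i ω) (2 * k) = walk (fun i => ξ n i ω) k)
    {δ : ℝ} (hδ : 0 < δ) :
    ∃ l : ℕ, ∀ᵐ ω ∂P, ∀ i : ℕ, ∃ p, ¬ HasOsc (dyadicPath fun n => walk fun j => ξ n j ω) dyadics
      (2 * (2 * δ)) p (i / 2 ^ l) ((i + 1 : ℕ) / 2 ^ l) := by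
  obtain ⟨η, hη, hsmall⟩ := exists_measureReal_norm_gt_le ψ hδ
  obtain ⟨l, hl⟩ := exists_pow_lt_of_lt_one hη (by norm_num : (1 / 2 : ℝ) < 1)
  refine ⟨l, ae_all_iff.2 fun i => ?_⟩
  have hbound : ∀ n a b, l ≤ n → a ≤ b → b ≤ a + 2 ^ (n - l) →
      P.real {ω | δ < ‖walk (fun j => ξ n j ω) b - walk (fun j => ξ n j ω) a‖} ≤ 1 / 3 := by
    intro n a b hn hab hba
    have hmeas : Measurable fun ω => walk (fun j => ξ n j ω) b - walk (fun j => ξ n j ω) a :=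
      (measurable_walk (hm n) b).sub (measurable_walk (hm n) a)
    have hpr : IsProbabilityMeasure
        (P.map fun ω => walk (fun j => ξ n j ω) b - walk (fun j => ξ n j ω) a) :=
      Measure.isProbabilityMeasure_map hmeas.aemeasurable
    have hab' : (a : ℝ) ≤ b := by exact_mod_cast hab
    have h1 := hsmall (P.map fun ω => walk (fun j => ξ n j ω) b - walk (fun j => ξ n j ω) a)
      ((b - a) / 2 ^ n) (by have := sub_nonneg.2 hab'; positivity) ?_ fun y => ?_
    · rwa [map_measureReal_apply hmeas (measurableSet_lt measurable_const measurable_norm)] at h1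
    · refine le_trans ?_ hl.le
      have h2 : (b : ℝ) ≤ a + 2 ^ (n - l) := by exact_mod_cast hba
      have h3 : (2 : ℝ) ^ n = 2 ^ l * 2 ^ (n - l) := by rw [← pow_add, Nat.add_sub_cancel' hn]
      rw [div_le_iff₀ (by positivity), h3, ← mul_assoc, ← mul_pow]
      norm_num
      linarith
    · rw [charFun_map_walk_sub_walk (hm n) (hind n) (hlaw n) hab]
      congr 1
      push_cast
      ring
  have hnull : P {ω | ∀ p, ∀ᶠ n in atTop, HasExits (walk fun j => ξ n j ω) (2 * δ)
      (2 ^ (n - l) * (i + 1)) p (2 ^ (n - l) * i)} = 0 := by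
    have hle : ∀ p : ℕ, P {ω | ∀ p, ∀ᶠ n in atTop, HasExits (walk fun j => ξ n j ω) (2 * δ)
        (2 ^ (n - l) * (i + 1)) p (2 ^ (n - l) * i)} ≤ ENNReal.ofReal ((1 / 2) ^ p) := by
      intro p
      refine (measure_mono fun ω hω => ?_).trans (measure_eventually_le P
        (fun n => {ω | HasExits (walk fun j => ξ n j ω) (2 * δ) (2 ^ (n - l) * (i + 1)) p
          (2 ^ (n - l) * i)}) ?_)
      · exact hω p
      · filter_upwards [eventually_ge_atTop l] with n hn
        refine (ENNReal.le_ofReal_iff_toReal_le (measure_ne_top _ _) (by positivity)).2 ?_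
        refine measureReal_hasExits_le (hm n) (hind n) (a₀ := 2 ^ (n - l) * i) ?_ p _ le_rfl ?_
        · intro j k hj hjk hk
          exact hbound n j k hn hjk (by linarith)
        · gcongr
          omega
    have hlim : Tendsto (fun p : ℕ => ENNReal.ofReal ((1 / 2) ^ p)) atTop (𝓝 0) := by
      have := ENNReal.tendsto_ofReal
        (tendsto_pow_atTop_nhds_zero_of_lt_one (by norm_num : (0 : ℝ) ≤ 1 / 2) (by norm_num))
      simpa using this
    exact le_antisymm (ge_of_tendsto' hlim hle) zero_le
  have hae : ∀ᵐ ω ∂P, ¬ ∀ p, ∀ᶠ n in atTop, HasExits (walk fun j => ξ n j ω) (2 * δ)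
      (2 ^ (n - l) * (i + 1)) p (2 ^ (n - l) * i) := by
    rw [ae_iff]
    simpa using hnull
  filter_upwards [hS, hae] with ω hω hω'
  by_contra! hcon
  refine hω' fun p => ?_
  filter_upwards [(hcon p).eventually_of_dyadicPath hω, eventually_ge_atTop l] with n hn hln
  have hfl : ∀ k : ℕ, ⌊(2 ^ n * (k / 2 ^ l) : ℝ≥0)⌋₊ = 2 ^ (n - l) * k := by
    intro k
    obtain ⟨m, rfl⟩ := Nat.exists_eq_add_of_le hln
    have : (2 ^ (l + m) * (k / 2 ^ l) : ℝ≥0) = (2 ^ (l + m - l) * k : ℕ) := by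
      rw [Nat.add_sub_cancel_left]
      push_cast
      field_simp
      ring
    rw [this, Nat.floor_natCast]
  rw [hfl, hfl] at hn
  exact hn.hasExits (by positivity)

theorem tendsto_floor_sub_floor_div (s t : ℝ≥0) :
    Tendsto (fun n : ℕ => (((⌊2 ^ n * t⌋₊ + 1 : ℕ) - (⌊2 ^ n * s⌋₊ + 1 : ℕ) : ℝ) / 2 ^ n)) atTop
      (𝓝 (t - s)) := by
  have h : ∀ t : ℝ≥0, Tendsto (fun n : ℕ => (((⌊2 ^ n * t⌋₊ + 1 : ℕ) : ℝ) / 2 ^ n)) atTop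
      (𝓝 t) := fun t => by
    have := (NNReal.continuous_coe.tendsto t).comp
      (tendsto_nhdsWithin_iff.1 (tendsto_succ_floor_dyadic t)).1
    refine this.congr fun n => by simp
  refine ((h t).sub (h s)).congr fun n => by ring

/-- Every infinitely divisible law is the law at time one of a Lévy process. -/
theorem InfDiv.exists_isLevyProcess {ν : Measure (E d)} (hν : InfDiv ν) :
    ∃ (Ω : Type) (_ : MeasurableSpace Ω) (P : Measure Ω) (Y : ℝ≥0 → Ω → E d),
      IsProbabilityMeasure P ∧ IsLevyProcess P Y ∧ HasLaw (Y 1) ν P := by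
  obtain ⟨ψ, hψ⟩ := hν.exists_hasExponent
  choose μ _ hμ using fun n : ℕ => hν.exists_root hψ (n := 2 ^ n) (by positivity)
  have hμp : ∀ n, IsProbabilityMeasure (μ n) := fun n => (hμ n).isProb
  obtain ⟨Ω, mΩ, P, ξ, hP, hm, hind, hlaw, hadd⟩ := exists_nested_walks μ fun n => by
    refine ((hμ (n + 1)).conv (hμ (n + 1))).measure_eq ?_
    convert hμ n using 2
    push_cast
    ring
  have hchar : ∀ n i y, charFun (P.map (ξ n i)) y = Complex.exp (ψ y / 2 ^ n) := fun n i y => by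
    rw [hlaw, (hμ n).charFun_eq]
    push_cast
    rfl
  have hS : ∀ᵐ ω ∂P, ∀ n k, walk (fun i => ξ (n + 1) i ω) (2 * k) = walk (fun i => ξ n i ω) k := by
    filter_upwards [hadd] with ω hω n k
    induction k with
    | zero => simp [walk]
    | succ k ih =>
      simp only [walk, Nat.mul_succ, Finset.sum_range_succ] at ih ⊢
      rw [ih, hω n k, add_assoc]
  let Z : ℕ → ℝ≥0 → Ω → E d := fun n t ω => walk (fun i => ξ n i ω) (⌊2 ^ n * t⌋₊ + 1)
  have hZm : ∀ n t, Measurable (Z n t) := fun n t => measurable_walk (hm n) _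
  have hgood : ∀ᵐ ω ∂P, ∃ y : ℝ≥0 → E d, (∀ t, Tendsto (fun n => Z n t ω) atTop (𝓝 (y t))) ∧
      (∀ t, Tendsto y (𝓝[>] t) (𝓝 (y t))) ∧ ∀ t, ∃ l, Tendsto y (𝓝[<] t) (𝓝 l) := by
    choose l hl using fun q : ℕ => exists_ae_exists_not_hasOsc hm hind hchar hS
      (δ := 1 / (q + 1)) (by positivity)
    filter_upwards [hS, ae_all_iff.2 hl] with ω hω hω'
    refine exists_cadlag_of_not_hasOsc hω fun ε hε => ?_
    obtain ⟨q, hq⟩ := exists_nat_one_div_lt (show (0 : ℝ) < ε / 4 by positivity)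
    refine ⟨l q, fun i => ?_⟩
    obtain ⟨p, hp⟩ := hω' q i
    exact ⟨p, fun h => hp (h.mono_size (by linarith))⟩
  -- `IsLevyProcess` asks for regular paths at every `ω`; on a measurable null set containing all
  -- bad `ω` the path is replaced by zero.
  obtain ⟨N, hN, hNm, hN0⟩ := exists_measurable_superset_of_null (ae_iff.1 hgood)
  have hN' : ∀ ω ∉ N, ∃ y : ℝ≥0 → E d, (∀ t, Tendsto (fun n => Z n t ω) atTop (𝓝 (y t))) ∧
      (∀ t, Tendsto y (𝓝[>] t) (𝓝 (y t))) ∧ ∀ t, ∃ l, Tendsto y (𝓝[<] t) (𝓝 l) := by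
    intro ω hω
    by_contra hcon
    exact hω (hN hcon)
  classical
  choose! y hy1 hy2 hy3 using hN'
  let X : ℝ≥0 → Ω → E d := fun t => Nᶜ.indicator fun ω => y ω t
  have hX : ∀ t ω, ω ∉ N → X t ω = y ω t := fun t ω hω => Set.indicator_of_mem hω _
  have hX0 : ∀ t ω, ω ∈ N → X t ω = 0 := fun t ω hω =>
    Set.indicator_of_notMem (by simpa using hω) _
  have hXm : ∀ t, Measurable (X t) := by
    intro t
    refine measurable_of_tendsto_metrizable
      (fun n => (hZm n t).indicator hNm.compl) (tendsto_pi_nhds.2 fun ω => ?_)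
    by_cases hω : ω ∈ N
    · rw [hX0 t ω hω]
      refine tendsto_const_nhds.congr fun n => ?_
      exact (Set.indicator_of_notMem (by simpa using hω) _).symm
    · rw [hX t ω hω]
      refine (hy1 ω hω t).congr fun n => ?_
      exact (Set.indicator_of_mem (show ω ∈ Nᶜ from hω) _).symm
  have hae : ∀ᵐ ω ∂P, ω ∉ N := by rw [ae_iff]; simpa using hN0
  have hlim : ∀ s t, ∀ᵐ ω ∂P,
      Tendsto (fun n => Z n t ω - Z n s ω) atTop (𝓝 (X t ω - X s ω)) := by
    intro s t
    filter_upwards [hae] with ω hω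
    rw [hX t ω hω, hX s ω hω]
    exact (hy1 ω hω t).sub (hy1 ω hω s)
  have hincr : ∀ s t, s ≤ t → ∀ z, charFun (P.map fun ω => X t ω - X s ω) z =
      Complex.exp ((t - s : ℝ) * ψ z) := by
    intro s t hst z
    have h1 := tendsto_charFun_map_of_tendsto_ae
      (fun n => ((hZm n t).sub (hZm n s)).aemeasurable) ((hXm t).sub (hXm s)).aemeasurable
      (hlim s t) z
    have h2 := (Complex.continuous_exp.tendsto _).comp
      (((Complex.continuous_ofReal.tendsto _).comp (tendsto_floor_sub_floor_div s t)).mul_const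
        (ψ z))
    refine tendsto_nhds_unique h1 (h2.congr fun n => ?_)
    have hle : ⌊2 ^ n * s⌋₊ + 1 ≤ ⌊2 ^ n * t⌋₊ + 1 := by gcongr
    refine Eq.trans ?_ (charFun_map_walk_sub_walk (hm n) (hind n) (hchar n) hle z).symm
    simp only [Function.comp_apply]
    congr 1
    push_cast
    ring
  have hmap_eq : ∀ s t s' t' : ℝ≥0, s ≤ t → s' ≤ t' → (t - s : ℝ) = t' - s' →
      (P.map fun ω => X t ω - X s ω) = P.map fun ω => X t' ω - X s' ω := by
    intro s t s' t' hst hst' heq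
    have := Measure.isProbabilityMeasure_map (μ := P) ((hXm t).sub (hXm s)).aemeasurable
    have := Measure.isProbabilityMeasure_map (μ := P) ((hXm t').sub (hXm s')).aemeasurable
    refine Measure.ext_of_charFun (funext fun z => ?_)
    exact (hincr s t hst z).trans (heq ▸ (hincr s' t' hst' z).symm)
  -- Subtracting `X 0` makes every path start at zero without changing increments.
  refine ⟨Ω, mΩ, P, fun t ω => X t ω - X 0 ω, hP, ⟨fun t => (hXm t).sub (hXm 0), fun ω => sub_self _,
    ?_, fun s t => ?_, fun ω t => ?_, fun ω t => ?_⟩, ⟨((hXm 1).sub (hXm 0)).aemeasurable, ?_⟩⟩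
  · intro n t ht
    simp only [sub_sub_sub_cancel_right]
    refine iIndepFun_of_tendsto_ae
      (X := fun m (i : Fin n) ω => Z m (t i.succ) ω - Z m (t i.castSucc) ω)
      (fun m i => ((hZm m _).sub (hZm m _)).aemeasurable)
      (fun i => ((hXm _).sub (hXm _)).aemeasurable) (fun m => ?_) (fun i => hlim _ _)
    -- Truncating the index at `n` extends the finite family of times to a monotone sequence on `ℕ`.
    let a : ℕ → ℕ := fun k => ⌊2 ^ m * t ⟨min n k, by omega⟩⌋₊ + 1
    have ha : Monotone a := by
      intro j k hjk
      have : t ⟨min n j, by omega⟩ ≤ t ⟨min n k, by omega⟩ := ht (by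
        rw [Fin.mk_le_mk]; omega)
      dsimp only [a]
      gcongr
    have h1 := (iIndepFun_sum_Ico (hm m) (hind m) ha).precomp Fin.val_injective (ι' := Fin n)
    convert h1 using 2 with i
    ext1 ω
    rw [← walk_sub_walk (fun i => ξ m i ω) (ha (Nat.le_succ _))]
    have e1 : min n (i : ℕ) = i := by omega
    have e2 : min n ((i : ℕ) + 1) = i + 1 := by omega
    simp only [a, Z, e1, e2]
    rfl
  · simp only [sub_sub_sub_cancel_right]
    exact hmap_eq _ _ _ _ le_self_add zero_le (by push_cast; ring)
  · by_cases hω : ω ∈ N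
    · simp only [hX0 _ _ hω]
      exact continuousWithinAt_const
    · simp only [hX _ _ hω]
      exact (hy2 ω hω t).sub_const _
  · by_cases hω : ω ∈ N
    · simp only [hX0 _ _ hω]
      exact ⟨_, tendsto_const_nhds⟩
    · simp only [hX _ _ hω]
      obtain ⟨l, hl⟩ := hy3 ω hω t
      exact ⟨_, hl.sub_const _⟩
  · have := Measure.isProbabilityMeasure_map (μ := P) ((hXm 1).sub (hXm 0)).aemeasurable
    have := hν.1
    refine Measure.ext_of_charFun (funext fun z => ?_)
    refine (hincr 0 1 zero_le z).trans ?_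
    rw [hψ.charFun_eq]
    simp

end NestedWalks

/-! ### The random integral as a limit of Riemann–Stieltjes sums -/

/-- One-sided limits bound `y` near each point; compactness of `[0, b]` does the rest. -/
theorem exists_norm_le_of_cadlag {F : Type*} [NormedAddCommGroup F] {y : ℝ≥0 → F}
    (hr : ∀ t, ContinuousWithinAt y (Set.Ioi t) t) (hl : ∀ t, ∃ l, Tendsto y (𝓝[<] t) (𝓝 l))
    (b : ℝ≥0) : ∃ C, ∀ t ≤ b, ‖y t‖ ≤ C := by
  have h : ∃ C, ∀ t ∈ Set.Icc 0 b, ‖y t‖ ≤ C := by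
    refine isCompact_Icc.induction_on (p := fun s => ∃ C, ∀ t ∈ s, ‖y t‖ ≤ C) ⟨0, by simp⟩
      (fun s t hst ⟨C, hC⟩ => ⟨C, fun u hu => hC u (hst hu)⟩)
      (fun s t ⟨C, hC⟩ ⟨C', hC'⟩ => ⟨max C C', ?_⟩) fun t _ => ?_
    · rintro u (hu | hu)
      · exact (hC u hu).trans (le_max_left _ _)
      · exact (hC' u hu).trans (le_max_right _ _)
    · obtain ⟨l, hl⟩ := hl t
      have h1 : ∀ᶠ s in 𝓝[<] t, ‖y s‖ ≤ ‖l‖ + 1 :=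
        (hl.norm.eventually_lt_const (lt_add_one _)).mono fun _ h => h.le
      have h2 : ∀ᶠ s in 𝓝[>] t, ‖y s‖ ≤ ‖y t‖ + 1 :=
        ((hr t).norm.eventually_lt_const (lt_add_one _)).mono fun _ h => h.le
      have h3 : ∀ᶠ s in 𝓝 t, ‖y s‖ ≤ max (‖l‖ + 1) (‖y t‖ + 1) := by
        rw [← nhdsNE_sup_pure, ← nhdsLT_sup_nhdsGT, eventually_sup, eventually_sup,
          eventually_pure]
        exact ⟨⟨h1.mono fun _ h => h.trans (le_max_left _ _),
          h2.mono fun _ h => h.trans (le_max_right _ _)⟩,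
          (le_add_of_nonneg_right zero_le_one).trans (le_max_right _ _)⟩
      exact ⟨_, mem_nhdsWithin_of_mem_nhds h3, _, fun u hu => hu⟩
  obtain ⟨C, hC⟩ := h
  exact ⟨C, fun t ht => hC t ⟨zero_le, ht⟩⟩

theorem tendsto_ceil_div {t : ℝ} :
    Tendsto (fun N : ℕ => (⌈(N + 1 : ℕ) * t⌉₊ / (N + 1 : ℕ) : ℝ≥0)) atTop
      (𝓝[≥] t.toNNReal) := by
  have hge : ∀ N : ℕ, t.toNNReal ≤ (⌈(N + 1 : ℕ) * t⌉₊ / (N + 1 : ℕ) : ℝ≥0) := by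
    intro N
    rw [Real.toNNReal_le_iff_le_coe]
    push_cast
    rw [le_div_iff₀ (by positivity), mul_comm]
    exact_mod_cast Nat.le_ceil _
  have hle : ∀ N : ℕ, (⌈(N + 1 : ℕ) * t⌉₊ / (N + 1 : ℕ) : ℝ≥0) ≤
      t.toNNReal + (1 / (N + 1) : ℝ≥0) := by
    intro N
    rw [div_le_iff₀ (by positivity), add_mul]
    push_cast
    rw [one_div_mul_cancel (by positivity), ← NNReal.coe_le_coe]
    push_cast
    rcases le_total 0 t with h | h
    · have := (Nat.ceil_lt_add_one (by positivity : 0 ≤ ((N : ℝ) + 1) * t)).le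
      rw [Real.coe_toNNReal t h, mul_comm t]
      exact_mod_cast this
    · have : ⌈((N : ℝ) + 1) * t⌉₊ = 0 :=
        Nat.ceil_eq_zero.2 (mul_nonpos_of_nonneg_of_nonpos (by positivity) h)
      rw [this]
      simp only [CharP.cast_eq_zero]
      positivity
  refine tendsto_nhdsWithin_iff.2 ⟨?_, Eventually.of_forall hge⟩
  refine tendsto_of_tendsto_of_tendsto_of_le_of_le tendsto_const_nhds ?_ hge hle
  have : Tendsto (fun n : ℕ => (1 / (n + 1) : ℝ≥0)) atTop (𝓝 0) := by
    rw [← NNReal.tendsto_coe]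
    push_cast
    exact tendsto_one_div_add_atTop_nhds_zero_nat
  simpa using this.const_add t.toNNReal

section RiemannSum

variable {F : Type*} [NormedAddCommGroup F] [NormedSpace ℝ F] [CompleteSpace F] {f : ℝ → ℝ}

/-- On each cell the ceiling freezes `y` at the right endpoint, and `deriv f` integrates to the
increment of `f`. -/
theorem integral_deriv_smul_ceil (hf : ContinuousOn f (Set.Icc 0 1))
    (hd : ∀ t ∈ Set.Ioo (0 : ℝ) 1, DifferentiableAt ℝ f t)
    (hi : IntervalIntegrable (deriv f) volume 0 1) (y : ℝ≥0 → F) (N : ℕ) :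
    ∫ t in (0 : ℝ)..1, deriv f t • y (⌈(N + 1 : ℕ) * t⌉₊ / (N + 1 : ℕ)) =
      ∑ k ∈ Finset.range (N + 1), (f ((k + 1 : ℕ) / (N + 1 : ℕ)) - f (k / (N + 1 : ℕ))) •
        y ((k + 1 : ℕ) / (N + 1 : ℕ)) := by
  have hN : (0 : ℝ) < (N + 1 : ℕ) := by positivity
  let a : ℕ → ℝ := fun k => k / (N + 1 : ℕ)
  have ha : ∀ k, a k ≤ a (k + 1) := fun k => by
    dsimp only [a]; gcongr; omega
  have ha0 : ∀ k, 0 ≤ a k := fun k => by positivity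
  have ha1 : ∀ k < N + 1, a (k + 1) ≤ 1 := fun k hk => by
    dsimp only [a]
    rw [div_le_one hN]
    exact_mod_cast hk
  have hsub : ∀ k < N + 1, Set.uIcc (a k) (a (k + 1)) ⊆ Set.uIcc 0 1 := fun k hk => by
    rw [Set.uIcc_of_le (ha k), Set.uIcc_of_le zero_le_one]
    exact Set.Icc_subset_Icc (ha0 k) (ha1 k hk)
  have hceil : ∀ k, ∀ t ∈ Set.Ioc (a k) (a (k + 1)), ⌈(N + 1 : ℕ) * t⌉₊ = k + 1 := by
    intro k t ht
    rw [Nat.ceil_eq_iff (by omega)]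
    constructor
    · have := (div_lt_iff₀ hN).1 ht.1
      rw [Nat.add_sub_cancel, mul_comm]
      exact this
    · have := (le_div_iff₀ hN).1 ht.2
      rw [mul_comm]
      exact this
  have hcongr : ∀ k, Set.EqOn (fun t => deriv f t • y (⌈(N + 1 : ℕ) * t⌉₊ / (N + 1 : ℕ)))
      (fun t => deriv f t • y ((k + 1 : ℕ) / (N + 1 : ℕ))) (Set.uIoc (a k) (a (k + 1))) := by
    intro k t ht
    rw [Set.uIoc_of_le (ha k)] at ht
    simp only [hceil k t ht]
  have hdi : ∀ k < N + 1, IntervalIntegrable (deriv f) volume (a k) (a (k + 1)) :=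
    fun k hk => hi.mono_set (hsub k hk)
  have hsum := intervalIntegral.sum_integral_adjacent_intervals (μ := volume)
    (f := fun t => deriv f t • y (⌈(N + 1 : ℕ) * t⌉₊ / (N + 1 : ℕ))) (a := a) (n := N + 1)
    fun k hk => IntervalIntegrable.congr (fun t ht => (hcongr k ht).symm)
      ⟨Integrable.smul_const (hdi k hk).1 _, Integrable.smul_const (hdi k hk).2 _⟩
  have ha00 : a 0 = 0 := by simp [a]
  have ha11 : a (N + 1) = 1 := div_self hN.ne'
  rw [ha00, ha11] at hsum
  rw [← hsum]
  refine Finset.sum_congr rfl fun k hk => ?_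
  rw [Finset.mem_range] at hk
  rw [intervalIntegral.integral_congr_ae (ae_of_all _ fun t ht => hcongr k ht),
    intervalIntegral.integral_smul_const,
    intervalIntegral.integral_eq_sub_of_hasDerivAt_of_le (ha k)
      (hf.mono (Set.Icc_subset_Icc (ha0 k) (ha1 k hk)))
      (fun t ht => (hd t ⟨(ha0 k).trans_lt ht.1, ht.2.trans_le (ha1 k hk)⟩).hasDerivAt) (hdi k hk)]

theorem tendsto_sum_smul_integral (hf : ContinuousOn f (Set.Icc 0 1))
    (hd : ∀ t ∈ Set.Ioo (0 : ℝ) 1, DifferentiableAt ℝ f t)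
    (hi : IntervalIntegrable (deriv f) volume 0 1) {y : ℝ≥0 → F}
    (hr : ∀ t, ContinuousWithinAt y (Set.Ioi t) t) {C : ℝ} (hC : ∀ t ≤ 1, ‖y t‖ ≤ C) :
    Tendsto (fun N : ℕ => ∑ k ∈ Finset.range (N + 1),
      (f ((k + 1 : ℕ) / (N + 1 : ℕ)) - f (k / (N + 1 : ℕ))) • y ((k + 1 : ℕ) / (N + 1 : ℕ))) atTop
      (𝓝 (∫ t in (0 : ℝ)..1, deriv f t • y t.toNNReal)) := by
  simp_rw [← integral_deriv_smul_ceil hf hd hi y]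
  refine intervalIntegral.tendsto_integral_filter_of_dominated_convergence
    (fun t => ‖deriv f t‖ * C) (Eventually.of_forall fun N => ?_) (Eventually.of_forall fun N => ?_)
    (hi.norm.mul_const C) (ae_of_all _ fun t _ => ?_)
  · refine AEStronglyMeasurable.smul (f := deriv f) ?_ ?_
    · exact (measurable_deriv f).aestronglyMeasurable
    · have h1 : StronglyMeasurable fun k : ℕ => y (k / (N + 1 : ℕ)) :=
        StronglyMeasurable.of_discrete
      exact (h1.comp_measurable
        (Nat.measurable_ceil.comp (measurable_const_mul ((N + 1 : ℕ) : ℝ)))).aestronglyMeasurable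
  · refine ae_of_all _ fun t ht => ?_
    rw [Set.uIoc_of_le zero_le_one] at ht
    rw [norm_smul]
    refine mul_le_mul_of_nonneg_left (hC _ ?_) (norm_nonneg _)
    rw [div_le_one (by positivity)]
    have : ⌈(N + 1 : ℕ) * t⌉₊ ≤ N + 1 :=
      Nat.ceil_le.2 (mul_le_of_le_one_right (by positivity) ht.2)
    exact_mod_cast this
  · refine Tendsto.const_smul ?_ _
    exact (continuousWithinAt_Ioi_iff_Ici.1 (hr _)).tendsto.comp tendsto_ceil_div

/-- Summation by parts turns sums against `df` into sums against `dy`. Right endpoints for `y` in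
the former become left endpoints for `f` in the latter. -/
theorem tendsto_sum_smul_increments (hf : ContinuousOn f (Set.Icc 0 1))
    (hd : ∀ t ∈ Set.Ioo (0 : ℝ) 1, DifferentiableAt ℝ f t)
    (hi : IntervalIntegrable (deriv f) volume 0 1) {y : ℝ≥0 → F}
    (hr : ∀ t, ContinuousWithinAt y (Set.Ioi t) t) (hl : ∀ t, ∃ l, Tendsto y (𝓝[<] t) (𝓝 l)) :
    Tendsto (fun N : ℕ => ∑ k ∈ Finset.range (N + 1),
      f (k / (N + 1 : ℕ)) • (y ((k + 1 : ℕ) / (N + 1 : ℕ)) - y (k / (N + 1 : ℕ)))) atTop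
      (𝓝 (f 1 • y 1 - f 0 • y 0 - ∫ t in (0 : ℝ)..1, deriv f t • y t.toNNReal)) := by
  obtain ⟨C, hC⟩ := exists_norm_le_of_cadlag hr hl 1
  refine ((tendsto_sum_smul_integral hf hd hi hr hC).const_sub (f 1 • y 1 - f 0 • y 0)).congr
    fun N => ?_
  have h1 := Finset.sum_range_sub
    (fun k : ℕ => f (k / (N + 1 : ℕ)) • y (k / (N + 1 : ℕ))) (N + 1)
  have e1 : ((N + 1 : ℕ) : ℝ) / (N + 1 : ℕ) = 1 := div_self (by positivity)
  have e2 : ((N + 1 : ℕ) : ℝ≥0) / (N + 1 : ℕ) = 1 := div_self (by positivity)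
  simp only [e1, e2, CharP.cast_eq_zero, zero_div] at h1
  rw [← h1, ← Finset.sum_sub_distrib]
  refine Finset.sum_congr rfl fun k _ => ?_
  module

theorem tendsto_average_integral {g : ℝ → F} (hg : Continuous g) :
    Tendsto (fun N : ℕ => ((N + 1 : ℕ) : ℝ)⁻¹ • ∑ k ∈ Finset.range (N + 1), g (k / (N + 1 : ℕ)))
      atTop (𝓝 (∫ t in (0 : ℝ)..1, g t)) := by
  have hgc : Continuous fun t : ℝ≥0 => g t := hg.comp NNReal.continuous_coe
  obtain ⟨C, hC⟩ := exists_norm_le_of_cadlag (y := fun t : ℝ≥0 => g t)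
    (fun t => hgc.continuousWithinAt) (fun t => ⟨_, hgc.continuousWithinAt.tendsto⟩) 1
  have h1 := tendsto_sum_smul_integral (f := id) continuousOn_id (fun t _ => differentiableAt_id)
    (by simp) (y := fun t : ℝ≥0 => g t) (fun t => hgc.continuousWithinAt) hC
  -- Sums over left and right endpoints differ by `(g 1 - g 0) / (N + 1)`.
  have h2 : Tendsto (fun N : ℕ => ((N + 1 : ℕ) : ℝ)⁻¹ • (g 1 - g 0)) atTop (𝓝 0) := by
    have h3 : Tendsto (fun N : ℕ => ((N + 1 : ℕ) : ℝ)⁻¹) atTop (𝓝 0) := by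
      simpa using tendsto_one_div_add_atTop_nhds_zero_nat (𝕜 := ℝ)
    simpa using h3.smul_const (g 1 - g 0)
  have h3 := h1.sub h2
  have e : ∫ t in (0 : ℝ)..1, deriv id t • g (t.toNNReal : ℝ) = ∫ t in (0 : ℝ)..1, g t := by
    refine intervalIntegral.integral_congr fun t ht => ?_
    rw [Set.uIcc_of_le zero_le_one] at ht
    simp [ht.1]
  rw [e, sub_zero] at h3
  refine h3.congr fun N => ?_
  have hN : ((N + 1 : ℕ) : ℝ) ≠ 0 := by positivity
  have h4 := Finset.sum_range_sub (fun k : ℕ => g (k / (N + 1 : ℕ))) (N + 1)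
  simp only [div_self hN, CharP.cast_eq_zero, zero_div] at h4
  rw [← h4, Finset.smul_sum, Finset.smul_sum, ← Finset.sum_sub_distrib]
  refine Finset.sum_congr rfl fun k _ => ?_
  have h5 : ((k + 1 : ℕ) : ℝ) / (N + 1 : ℕ) - k / (N + 1 : ℕ) = ((N + 1 : ℕ) : ℝ)⁻¹ := by
    push_cast
    field_simp
    ring
  simp only [id]
  rw [h5, smul_sub]
  simp

end RiemannSum

section RandomIntegral

variable {Ω : Type*} {mΩ : MeasurableSpace Ω} {P : Measure Ω}
  {Y : ℝ≥0 → Ω → E d} {ν : Measure (E d)} {ψ : E d → ℂ}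

/-- `Y 1` is a sum of `N + 1` independent increments of equal law, so this law is the `(N + 1)`-th
root of `ν`. -/
theorem IsLevyProcess.hasExponent_map [IsProbabilityMeasure P] (hY : IsLevyProcess P Y) (hlaw : HasLaw (Y 1) ν P)
    (hψ : HasExponent ν ψ) (N : ℕ) :
    HasExponent (P.map (Y (1 / (N + 1 : ℕ)))) (fun y => ψ y / (N + 1 : ℕ)) := by
  have hτ : IsProbabilityMeasure (P.map (Y (1 / (N + 1 : ℕ)))) :=
    Measure.isProbabilityMeasure_map (hY.measurable _).aemeasurable
  have := hψ.isProb
  refine hψ.of_convPow_eq (n := N + 1) (by omega) (Measure.ext_of_charFun (funext fun y => ?_))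
  have hmon : Monotone fun k : ℕ => (k / (N + 1 : ℕ) : ℝ≥0) := fun i j hij => by
    dsimp only; gcongr
  have hind := hY.indep.nat hmon
  have hincr : ∀ k : ℕ, P.map (fun ω => Y ((k + 1 : ℕ) / (N + 1 : ℕ)) ω - Y (k / (N + 1 : ℕ)) ω) =
      P.map (Y (1 / (N + 1 : ℕ))) := fun k => by
    rw [← hY.stationary (k / (N + 1 : ℕ))]
    congr! 4
    push_cast
    ring
  have hsum : ∀ ω, Y 1 ω = ∑ k ∈ Finset.range (N + 1),
      (Y ((k + 1 : ℕ) / (N + 1 : ℕ)) ω - Y (k / (N + 1 : ℕ)) ω) := fun ω => by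
    have h := Finset.sum_range_sub (fun k : ℕ => Y (k / (N + 1 : ℕ)) ω) (N + 1)
    have e2 : ((N + 1 : ℕ) : ℝ≥0) / (N + 1 : ℕ) = 1 := div_self (by positivity)
    simp only [e2, CharP.cast_eq_zero, zero_div, hY.zero, sub_zero] at h
    exact h.symm
  have h1 := (hind.restrict (Finset.range (N + 1))).charFun_map_fun_finsetSum_eq_prod
    (X := fun (i : ℕ) ω => Y ((i + 1 : ℕ) / (N + 1 : ℕ)) ω - Y (i / (N + 1 : ℕ)) ω)
    (fun i _ => ((hY.measurable _).sub (hY.measurable _)).aemeasurable)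
  rw [charFun_convPow, ← hlaw.map_eq, funext hsum, h1, Finset.prod_apply]
  simp only [hincr, Finset.prod_const, Finset.card_range]

theorem IsLevyProcess.charFun_sum_smul_increments [IsProbabilityMeasure P] (hY : IsLevyProcess P Y)
    (hlaw : HasLaw (Y 1) ν P) (hψ : HasExponent ν ψ) (f : ℝ → ℝ) (N : ℕ) (y : E d) :
    charFun (P.map fun ω => ∑ k ∈ Finset.range (N + 1), f (k / (N + 1 : ℕ)) •
      (Y ((k + 1 : ℕ) / (N + 1 : ℕ)) ω - Y (k / (N + 1 : ℕ)) ω)) y =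
      Complex.exp (((N + 1 : ℕ) : ℝ)⁻¹ •
        ∑ k ∈ Finset.range (N + 1), ψ (f (k / (N + 1 : ℕ)) • y)) := by
  have hmon : Monotone fun k : ℕ => (k / (N + 1 : ℕ) : ℝ≥0) := fun i j hij => by
    dsimp only; gcongr
  have hind := (hY.indep.nat hmon).comp (fun k x => f (k / (N + 1 : ℕ)) • x)
    fun k => measurable_const_smul _
  have hincr : ∀ k : ℕ, P.map (fun ω => Y ((k + 1 : ℕ) / (N + 1 : ℕ)) ω - Y (k / (N + 1 : ℕ)) ω) =
      P.map (Y (1 / (N + 1 : ℕ))) := fun k => by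
    rw [← hY.stationary (k / (N + 1 : ℕ))]
    congr! 4
    push_cast
    ring
  have h1 := (hind.restrict (Finset.range (N + 1))).charFun_map_fun_finsetSum_eq_prod
    (X := fun (i : ℕ) ω => f (i / (N + 1 : ℕ)) •
      (Y ((i + 1 : ℕ) / (N + 1 : ℕ)) ω - Y (i / (N + 1 : ℕ)) ω))
    (fun i _ => (((hY.measurable ((i + 1 : ℕ) / (N + 1 : ℕ))).sub
      (hY.measurable (i / (N + 1 : ℕ)))).const_smul (f (i / (N + 1 : ℕ)))).aemeasurable)
  refine (congrFun h1 y).trans ?_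
  rw [Finset.prod_apply, Finset.smul_sum, Complex.exp_sum]
  refine Finset.prod_congr rfl fun k _ => ?_
  refine (charFun_map_smul_comp
    (f := fun ω => Y ((k + 1 : ℕ) / (N + 1 : ℕ)) ω - Y (k / (N + 1 : ℕ)) ω) ((hY.measurable _).sub (hY.measurable _)).aemeasurable _ _).trans ?_
  rw [hincr, (hY.hasExponent_map hlaw hψ N).charFun_eq, Complex.real_smul, div_eq_inv_mul]
  push_cast
  rfl

variable {f : ℝ → ℝ}

theorem IsLevyProcess.tendsto_randomIntegral (hY : IsLevyProcess P Y)
    (hf : ContinuousOn f (Set.Icc 0 1))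
    (hd : ∀ t ∈ Set.Ioo (0 : ℝ) 1, DifferentiableAt ℝ f t)
    (hi : IntervalIntegrable (deriv f) volume 0 1) (ω : Ω) :
    Tendsto (fun N : ℕ => ∑ k ∈ Finset.range (N + 1), f (k / (N + 1 : ℕ)) •
      (Y ((k + 1 : ℕ) / (N + 1 : ℕ)) ω - Y (k / (N + 1 : ℕ)) ω)) atTop
      (𝓝 (randomIntegral f Y ω)) :=
  tendsto_sum_smul_increments (y := fun t => Y t ω) hf hd hi (hY.right_cont ω) (hY.left_lim ω)

theorem IsLevyProcess.measurable_sum_smul_increments (hY : IsLevyProcess P Y) (f : ℝ → ℝ) (N : ℕ) :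
    Measurable fun ω => ∑ k ∈ Finset.range (N + 1), f (k / (N + 1 : ℕ)) •
      (Y ((k + 1 : ℕ) / (N + 1 : ℕ)) ω - Y (k / (N + 1 : ℕ)) ω) :=
  Finset.measurable_fun_sum _ fun _ _ =>
    ((hY.measurable _).sub (hY.measurable _)).const_smul (_ : ℝ)

theorem IsLevyProcess.measurable_randomIntegral (hY : IsLevyProcess P Y)
    (hf : ContinuousOn f (Set.Icc 0 1))
    (hd : ∀ t ∈ Set.Ioo (0 : ℝ) 1, DifferentiableAt ℝ f t)
    (hi : IntervalIntegrable (deriv f) volume 0 1) : Measurable (randomIntegral f Y) :=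
  measurable_of_tendsto_metrizable (hY.measurable_sum_smul_increments f)
    (tendsto_pi_nhds.2 (hY.tendsto_randomIntegral hf hd hi))

/-- The sums converge pathwise to the integral, while their exponents are averages of `ψ (f t • y)`
over a grid, which converge to its integral. -/
theorem IsLevyProcess.charFun_randomIntegral [IsProbabilityMeasure P] (hY : IsLevyProcess P Y)
    (hlaw : HasLaw (Y 1) ν P) (hψ : HasExponent ν ψ) (hfc : Continuous f)
    (hd : ∀ t ∈ Set.Ioo (0 : ℝ) 1, DifferentiableAt ℝ f t)
    (hi : IntervalIntegrable (deriv f) volume 0 1) (y : E d) :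
    charFun (P.map (randomIntegral f Y)) y =
      Complex.exp (∫ t in (0 : ℝ)..1, ψ (f t • y)) := by
  have h1 := tendsto_charFun_map_of_tendsto_ae (P := P)
    (fun N => (hY.measurable_sum_smul_increments f N).aemeasurable)
    (hY.measurable_randomIntegral hfc.continuousOn hd hi).aemeasurable
    (ae_of_all _ (hY.tendsto_randomIntegral hfc.continuousOn hd hi)) y
  have hg : Continuous fun t => ψ (f t • y) := hψ.cont.comp (by fun_prop)
  have h2 := (Complex.continuous_exp.tendsto _).comp (tendsto_average_integral hg)
  refine tendsto_nhds_unique h1 (h2.congr fun N => ?_)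
  exact (hY.charFun_sum_smul_increments hlaw hψ f N y).symm

end RandomIntegral

/-! ### The operator `J` on exponents -/

/-- The characteristic exponent of `J γ ν` in terms of the characteristic exponent `ψ` of `ν`. -/
noncomputable def integralExponent (γ : ℝ) (ψ : E d → ℂ) (y : E d) : ℂ :=
  ∫ t in (0 : ℝ)..1, ψ (t ^ (1 / γ) • y)

theorem continuous_integralExponent {γ : ℝ} (hγ : 0 < γ) {ψ : E d → ℂ} (hψ : Continuous ψ) :
    Continuous (integralExponent γ ψ) := by
  have h : Continuous fun t : ℝ => t ^ (1 / γ) := Real.continuous_rpow_const (by positivity)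
  exact intervalIntegral.continuous_parametric_intervalIntegral_of_continuous' (by fun_prop) 0 1

theorem integralExponent_div (γ : ℝ) (ψ : E d → ℂ) (c : ℂ) :
    integralExponent γ (fun y => ψ y / c) = fun y => integralExponent γ ψ y / c := by
  ext y
  exact intervalIntegral.integral_div _ _

theorem IsLevyProcess.hasExponent_randomIntegral {Ω : Type*} {mΩ : MeasurableSpace Ω}
    {P : Measure Ω} [IsProbabilityMeasure P] {Y : ℝ≥0 → Ω → E d} {ν : Measure (E d)} {ψ : E d → ℂ}
    (hY : IsLevyProcess P Y) (hlaw : HasLaw (Y 1) ν P) (hψ : HasExponent ν ψ) {γ : ℝ} (hγ : 0 < γ) :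
    Measurable (randomIntegral (fun t : ℝ => t ^ (1 / γ)) Y) ∧
      HasExponent (P.map (randomIntegral (fun t : ℝ => t ^ (1 / γ)) Y))
        (integralExponent γ ψ) := by
  have hc : Continuous fun t : ℝ => t ^ (1 / γ) := Real.continuous_rpow_const (by positivity)
  have hd : ∀ t ∈ Set.Ioo (0 : ℝ) 1, DifferentiableAt ℝ (fun t : ℝ => t ^ (1 / γ)) t :=
    fun t ht => Real.differentiableAt_rpow_const_of_ne _ ht.1.ne'
  have hi : IntervalIntegrable (deriv fun t : ℝ => t ^ (1 / γ)) volume 0 1 := by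
    -- For `γ > 1` the derivative is unbounded at `0`, but its power `1 / γ - 1` exceeds `-1`.
    have h1 : IntervalIntegrable (fun t : ℝ => 1 / γ * t ^ (1 / γ - 1)) volume 0 1 :=
      (intervalIntegral.intervalIntegrable_rpow' (by have : 0 < 1 / γ := by positivity
                                                     linarith)).const_mul _
    refine h1.congr fun t ht => ?_
    rw [Set.uIoc_of_le zero_le_one] at ht
    exact (Real.hasDerivAt_rpow_const (Or.inl ht.1.ne')).deriv.symm
  have hm := hY.measurable_randomIntegral hc.continuousOn hd hi
  refine ⟨hm, Measure.isProbabilityMeasure_map hm.aemeasurable,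
    continuous_integralExponent hγ hψ.cont, by simp [integralExponent, hψ.zero],
    hY.charFun_randomIntegral hlaw hψ hc hd hi⟩

/-- The exponent of the integral depends on the process only through `ν`, so every choice of process
gives the same law; existence of a process gives the converse. -/
theorem InfDiv.isRandomIntegralLaw_iff_hasExponent {ν : Measure (E d)} (hν : InfDiv ν)
    {ψ : E d → ℂ} (hψ : HasExponent ν ψ) {γ : ℝ} (hγ : 0 < γ) (μ : Measure (E d)) :
    IsRandomIntegralLaw γ ν μ ↔ HasExponent μ (integralExponent γ ψ) := by
  constructor
  · rintro ⟨Ω, mΩ, P, Y, hP, hY, hlaw, hμ⟩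
    rw [← hμ.map_eq]
    exact (hY.hasExponent_randomIntegral hlaw hψ hγ).2
  · intro h
    obtain ⟨Ω, mΩ, P, Y, hP, hY, hlaw⟩ := hν.exists_isLevyProcess
    obtain ⟨h1, h2⟩ := hY.hasExponent_randomIntegral hlaw hψ hγ
    exact ⟨Ω, mΩ, P, Y, hP, hY, hlaw, h1.aemeasurable, h2.measure_eq h⟩

theorem InfDiv.isRandomIntegralLaw_J {ν : Measure (E d)} (hν : InfDiv ν) {γ : ℝ} (hγ : 0 < γ) :
    IsRandomIntegralLaw γ ν (J γ ν) := by
  obtain ⟨ψ, hψ⟩ := hν.exists_hasExponent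
  obtain ⟨Ω, mΩ, P, Y, hP, hY, hlaw⟩ := hν.exists_isLevyProcess
  obtain ⟨h1, -⟩ := hY.hasExponent_randomIntegral hlaw hψ hγ
  exact Classical.epsilon_spec (p := IsRandomIntegralLaw γ ν)
    ⟨_, Ω, mΩ, P, Y, hP, hY, hlaw, h1.aemeasurable, rfl⟩

theorem InfDiv.hasExponent_J {ν : Measure (E d)} (hν : InfDiv ν) {ψ : E d → ℂ}
    (hψ : HasExponent ν ψ) {γ : ℝ} (hγ : 0 < γ) : HasExponent (J γ ν) (integralExponent γ ψ) :=
  (hν.isRandomIntegralLaw_iff_hasExponent hψ hγ _).1 (hν.isRandomIntegralLaw_J hγ)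

theorem InfDiv.isRandomIntegralLaw_iff {ν : Measure (E d)} (hν : InfDiv ν) {γ : ℝ} (hγ : 0 < γ)
    (μ : Measure (E d)) : IsRandomIntegralLaw γ ν μ ↔ μ = J γ ν := by
  obtain ⟨ψ, hψ⟩ := hν.exists_hasExponent
  rw [hν.isRandomIntegralLaw_iff_hasExponent hψ hγ]
  refine ⟨fun h => h.measure_eq (hν.hasExponent_J hψ hγ), ?_⟩
  rintro rfl
  exact hν.hasExponent_J hψ hγ

theorem InfDiv.J {ν : Measure (E d)} (hν : InfDiv ν) {γ : ℝ} (hγ : 0 < γ) : InfDiv (J γ ν) := by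
  obtain ⟨ψ, hψ⟩ := hν.exists_hasExponent
  refine InfDiv.of_forall_hasExponent (hν.hasExponent_J hψ hγ) fun n hn => ?_
  obtain ⟨τ, hτ, hτe⟩ := hν.exists_root hψ (n := n) (by omega)
  rw [← integralExponent_div]
  exact ⟨_, hτ.hasExponent_J hτe hγ⟩

/-! ### The functional equation for exponents -/

/-- With `(A G)(x) = x⁻¹ ∫_0^x G` the average of `G` over `[0, x]`, the equation `A G + G = A H` is
solved by `G(x) = x⁻² ∫_0^x u H(u) du` and by no other continuous function. -/
theorem average_add_eq_average_iff {G H : ℝ → ℂ} (hG : Continuous G) (hH : Continuous H) :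
    (∀ x > (0 : ℝ), (∫ u in (0 : ℝ)..x, G u) + x * G x = ∫ u in (0 : ℝ)..x, H u) ↔
      ∀ x > (0 : ℝ), x ^ 2 * G x = ∫ u in (0 : ℝ)..x, u * H u := by
  have dK : ∀ x, HasDerivAt (fun x : ℝ => ∫ u in (0 : ℝ)..x, G u) (G x) x := fun x =>
    (hG.integral_hasStrictDerivAt 0 x).hasDerivAt
  have dL : ∀ x, HasDerivAt (fun x : ℝ => ∫ u in (0 : ℝ)..x, H u) (H x) x := fun x =>
    (hH.integral_hasStrictDerivAt 0 x).hasDerivAt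
  have hM : Continuous fun u : ℝ => (u : ℂ) * H u := by fun_prop
  have dM : ∀ x : ℝ, HasDerivAt (fun x : ℝ => ∫ u in (0 : ℝ)..x, (u : ℂ) * H u) (x * H x) x :=
    fun x => (hM.integral_hasStrictDerivAt 0 x).hasDerivAt
  have dx : ∀ x : ℝ, HasDerivAt (fun x : ℝ => (x : ℂ)) 1 x := fun x => Complex.ofRealCLM.hasDerivAt
  set K : ℝ → ℂ := fun x => ∫ u in (0 : ℝ)..x, G u
  set L : ℝ → ℂ := fun x => ∫ u in (0 : ℝ)..x, H u
  set M : ℝ → ℂ := fun x => ∫ u in (0 : ℝ)..x, (u : ℂ) * H u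
  have K0 : K 0 = 0 := intervalIntegral.integral_same
  have L0 : L 0 = 0 := intervalIntegral.integral_same
  have M0 : M 0 = 0 := intervalIntegral.integral_same
  -- `D = x L - x K - M` vanishes at zero
  have dD : ∀ x : ℝ, HasDerivAt (fun x : ℝ => x * L x - x * K x - M x)
      (L x - K x - x * G x) x := fun x => by
    refine ((((dx x).mul (dL x)).sub ((dx x).mul (dK x))).sub (dM x)).congr_deriv ?_
    ring
  constructor
  · intro h x hx
    have hconst : (fun x : ℝ => x * L x - x * K x - M x) x =
        (fun x : ℝ => x * L x - x * K x - M x) 0 := by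
      refine constant_of_has_deriv_right_zero (a := 0) (b := x)
        (fun u _ => (dD u).continuousAt.continuousWithinAt) (fun u hu => ?_) x ⟨hx.le, le_rfl⟩
      have : L u - K u - u * G u = 0 := by
        rcases hu.1.eq_or_lt with rfl | hu
        · simp [K0, L0]
        · linear_combination -(h u hu : K u + u * G u = L u)
      exact this ▸ (dD u).hasDerivWithinAt
    simp only [K0, L0, M0] at hconst
    have h1 := h x hx
    change K x + x * G x = L x at h1
    change _ = M x
    have h2 : M x = x * L x - x * K x := by linear_combination -hconst
    rw [h2, ← h1]
    ring
  · intro h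
    have hG' : ∀ x > (0 : ℝ), (x : ℂ) ^ 2 * G x = M x := h
    -- `x ↦ L - K - x G` is constant on `(0, ∞)`, with limit zero at zero
    set W : ℝ → ℂ := fun x => L x - K x - (x : ℂ)⁻¹ * M x
    have hW : ∀ x > (0 : ℝ), W x = L x - K x - x * G x := fun x hx => by
      have hx' : (x : ℂ) ≠ 0 := by exact_mod_cast (ne_of_gt hx)
      simp only [W, ← hG' x hx]
      field_simp
    have dW : ∀ x > (0 : ℝ), HasDerivAt W 0 x := fun x hx => by
      have hx' : (x : ℂ) ≠ 0 := by exact_mod_cast (ne_of_gt hx)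
      have hinv : HasDerivAt (fun x : ℝ => (x : ℂ)⁻¹) (-1 / (x : ℂ) ^ 2) x := (dx x).inv hx'
      refine (((dL x).sub (dK x)).sub (hinv.mul (dM x))).congr_deriv ?_
      rw [← hG' x hx]
      field_simp
      ring
    have hconst : ∀ x > (0 : ℝ), ∀ y > (0 : ℝ), W x = W y := by
      intro x hx y hy
      refine (convex_Ioi (0 : ℝ)).is_const_of_fderivWithin_eq_zero (𝕜 := ℝ)
        (fun u hu => (dW u hu).differentiableAt.differentiableWithinAt) (fun u hu => ?_) hx hy
      rw [fderivWithin_of_isOpen isOpen_Ioi hu]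
      ext
      simp [(dW u hu).deriv]
    have hlim : Tendsto W (𝓝[>] 0) (𝓝 0) := by
      have h1 : Tendsto (fun x : ℝ => L x - K x - x * G x) (𝓝 0) (𝓝 0) := by
        have hc : Continuous fun x : ℝ => L x - K x - x * G x := by
          have hKc : Continuous K := continuous_iff_continuousAt.2 fun x => (dK x).continuousAt
          have hLc : Continuous L := continuous_iff_continuousAt.2 fun x => (dL x).continuousAt
          fun_prop
        have := hc.tendsto 0
        simpa [K0, L0] using this
      refine (h1.mono_left nhdsWithin_le_nhds).congr' ?_
      filter_upwards [self_mem_nhdsWithin] with x hx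
      exact (hW x hx).symm
    intro x hx
    have hWx : W x = 0 := by
      refine tendsto_nhds_unique (tendsto_const_nhds.congr' ?_) hlim
      filter_upwards [self_mem_nhdsWithin] with u hu
      exact hconst x hx u hu
    rw [hW x hx] at hWx
    change K x + x * G x = L x
    linear_combination -hWx

theorem mul_integral_rpow_smul (χ : E d → ℂ) {β x : ℝ} (hx : 0 < x) (y : E d) :
    (x : ℂ) * integralExponent β χ (x ^ (1 / β) • y) =
      ∫ u in (0 : ℝ)..x, χ (u ^ (1 / β) • y) := by
  have h := intervalIntegral.smul_integral_comp_mul_right (a := 0) (b := 1)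
    (fun u : ℝ => χ (u ^ (1 / β) • y)) x
  rw [zero_mul, one_mul] at h
  rw [← h, Complex.real_smul, integralExponent]
  congr 1
  refine intervalIntegral.integral_congr fun t ht => ?_
  rw [Set.uIcc_of_le zero_le_one] at ht
  simp only [smul_smul]
  rw [Real.mul_rpow ht.1 hx.le]

/-- The substitution `v = u²` turns `v^{1/(2β)}` into `u^{1/β}`; the factor `2` from `dv = 2u du` is
what the convolution square root compensates. -/
theorem sq_mul_integralExponent_two_mul {χ : E d → ℂ} (hχ : Continuous χ) {β x : ℝ} (hβ : 0 < β)
    (hx : 0 < x) (y : E d) :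
    (x : ℂ) ^ 2 * integralExponent (2 * β) χ (x ^ (1 / β) • y) =
      2 * ∫ u in (0 : ℝ)..x, u * χ (u ^ (1 / β) • y) := by
  have hc : Continuous fun u : ℝ => χ (u ^ (1 / (2 * β)) • y) := by
    have : Continuous fun t : ℝ => t ^ (1 / (2 * β)) := Real.continuous_rpow_const (by positivity)
    fun_prop
  have h1 := mul_integral_rpow_smul χ (β := 2 * β)
    (show 0 < x ^ 2 by positivity) y
  have e1 : ∀ u : ℝ, 0 ≤ u → (u ^ 2) ^ (1 / (2 * β)) = u ^ (1 / β) := fun u hu => by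
    rw [← Real.rpow_natCast, ← Real.rpow_mul hu]
    congr 1
    field_simp
    norm_num
  rw [e1 x hx.le] at h1
  push_cast at h1
  rw [h1]
  have h2 := intervalIntegral.integral_deriv_smul_comp (a := 0) (b := x) (f := fun u : ℝ => u ^ 2)
    (f' := fun u => 2 * u) (g := fun u : ℝ => χ (u ^ (1 / (2 * β)) • y))
    (fun u _ => by simpa using hasDerivAt_pow 2 u) (by fun_prop) hc
  simp only [ne_eq, OfNat.ofNat_ne_zero, not_false_eq_true, zero_pow] at h2
  rw [← h2, ← intervalIntegral.integral_const_mul]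
  refine intervalIntegral.integral_congr fun t ht => ?_
  rw [Set.uIcc_of_le hx.le] at ht
  simp only [Function.comp_apply, e1 t ht.1, Complex.real_smul]
  push_cast
  ring

/-- Evaluating at `x^{1/β} y` and multiplying by `x`, respectively `x²`, gives the two sides of
`average_add_eq_average_iff`; `x = 1` recovers the value at `y`. -/
theorem integralExponent_add_eq_iff {ψ χ : E d → ℂ} (hψ : Continuous ψ) (hχ : Continuous χ)
    {β : ℝ} (hβ : 0 < β) :
    (∀ y, integralExponent β ψ y + ψ y = integralExponent β χ y) ↔
      ∀ y, ψ y = integralExponent (2 * β) χ y / 2 := by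
  have hcr : Continuous fun t : ℝ => t ^ (1 / β) := Real.continuous_rpow_const (by positivity)
  have hc : ∀ φ : E d → ℂ, Continuous φ → ∀ y, Continuous fun t : ℝ => φ (t ^ (1 / β) • y) :=
    fun φ hφ y => by fun_prop
  have key : ∀ y, (∀ x > (0 : ℝ), integralExponent β ψ (x ^ (1 / β) • y) + ψ (x ^ (1 / β) • y) =
        integralExponent β χ (x ^ (1 / β) • y)) ↔
      ∀ x > (0 : ℝ), ψ (x ^ (1 / β) • y) = integralExponent (2 * β) χ (x ^ (1 / β) • y) / 2 := by
    intro y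
    have h := average_add_eq_average_iff (hc ψ hψ y) (hc χ hχ y)
    have h1 : (∀ x > (0 : ℝ), integralExponent β ψ (x ^ (1 / β) • y) + ψ (x ^ (1 / β) • y) =
        integralExponent β χ (x ^ (1 / β) • y)) ↔ ∀ x > (0 : ℝ), (∫ u in (0 : ℝ)..x,
          ψ (u ^ (1 / β) • y)) + x * ψ (x ^ (1 / β) • y) =
          ∫ u in (0 : ℝ)..x, χ (u ^ (1 / β) • y) := by
      refine forall₂_congr fun x hx => ?_
      have hx' : (x : ℂ) ≠ 0 := by exact_mod_cast (ne_of_gt hx)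
      rw [← mul_integral_rpow_smul ψ hx, ← mul_integral_rpow_smul χ hx, ← mul_add]
      exact (mul_right_inj' hx').symm
    have h2 : (∀ x > (0 : ℝ), ψ (x ^ (1 / β) • y) = integralExponent (2 * β) χ (x ^ (1 / β) • y) / 2) ↔
        ∀ x > (0 : ℝ), (x : ℂ) ^ 2 * ψ (x ^ (1 / β) • y) =
          ∫ u in (0 : ℝ)..x, u * χ (u ^ (1 / β) • y) := by
      refine forall₂_congr fun x hx => ?_
      have hx' : (x : ℂ) ^ 2 ≠ 0 := pow_ne_zero _ (by exact_mod_cast (ne_of_gt hx))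
      have h3 := sq_mul_integralExponent_two_mul hχ hβ hx y
      have h4 : ∫ u in (0 : ℝ)..x, u * χ (u ^ (1 / β) • y) =
          (x : ℂ) ^ 2 * (integralExponent (2 * β) χ (x ^ (1 / β) • y) / 2) := by
        linear_combination -h3 / 2
      rw [h4]
      exact (mul_right_inj' hx').symm
    rw [h1, h2, h]
  constructor
  · intro h y
    simpa using (key y).1 (fun x _ => h _) 1 one_pos
  · intro h y
    simpa using (key y).2 (fun x _ => h _) 1 one_pos

/-- Fubini, since the two scalings commute. -/
theorem integralExponent_comm {ψ : E d → ℂ} (hψ : Continuous ψ) {γ δ : ℝ} (hγ : 0 < γ)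
    (hδ : 0 < δ) (y : E d) : integralExponent γ (integralExponent δ ψ) y =
      integralExponent δ (integralExponent γ ψ) y := by
  have hγ' : Continuous fun t : ℝ => t ^ (1 / γ) := Real.continuous_rpow_const (by positivity)
  have hδ' : Continuous fun t : ℝ => t ^ (1 / δ) := Real.continuous_rpow_const (by positivity)
  unfold integralExponent
  rw [intervalIntegral_intervalIntegral_swap]
  · simp only [smul_smul, mul_comm]
  · have hcont : Continuous (Function.uncurry fun t s : ℝ => ψ (s ^ (1 / δ) • t ^ (1 / γ) • y)) := by
      fun_prop
    refine (hcont.continuousOn.integrableOn_compact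
      ((isCompact_uIcc (a := 0) (b := 1)).prod (isCompact_uIcc (a := 0) (b := 1)))).mono_set ?_
    exact Set.prod_mono Set.uIoc_subset_uIcc Set.uIoc_subset_uIcc

/-! ### Factorization of laws -/

theorem InfDiv.J_conv_eq_iff {ρ ν : Measure (E d)} (hρ : InfDiv ρ) (hν : InfDiv ν) {β : ℝ}
    (hβ : 0 < β) : FactorizationProperty.J β ρ ∗ ρ = FactorizationProperty.J β ν ↔
      ρ = FactorizationProperty.J (2 * β) (FactorizationProperty.convSqrt ν) := by
  obtain ⟨ψ, hψ⟩ := hρ.exists_hasExponent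
  obtain ⟨χ, hχ⟩ := hν.exists_hasExponent
  have h1 := (hρ.hasExponent_J hψ hβ).conv hψ
  have h2 := hν.hasExponent_J hχ hβ
  have h3 := hν.convSqrt.hasExponent_J (hν.hasExponent_convSqrt hχ) (γ := 2 * β) (by positivity)
  rw [integralExponent_div] at h3
  have key := integralExponent_add_eq_iff hψ.cont hχ.cont hβ
  constructor
  · intro h
    rw [h] at h1
    have h4 : ψ = fun y => integralExponent (2 * β) χ y / 2 :=
      funext (key.1 (congrFun (h1.unique h2)))
    rw [h4] at hψ
    exact hψ.measure_eq h3
  · intro h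
    rw [← h] at h3
    have h4 := key.2 (congrFun (hψ.unique h3))
    rw [funext h4] at h1
    exact h1.measure_eq h2

theorem InfDiv.convSqrt_conv_self {τ : Measure (E d)} (hτ : InfDiv τ) :
    FactorizationProperty.convSqrt (τ ∗ τ) = τ :=
  (((hτ.conv hτ).isConvSqrt_iff τ).1 ⟨hτ.1, rfl⟩).symm

/-- Each infinitely divisible `τ` is the square root of `τ ∗ τ`, so taking roots maps `ID` onto
itself. -/
theorem mem_U_iff_exists_convSqrt {γ : ℝ} {ρ : Measure (E d)} :
    ρ ∈ U d γ ↔ ∃ ν, InfDiv ν ∧ ρ = J γ (convSqrt ν) := by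
  constructor
  · rintro ⟨τ, hτ, rfl⟩
    exact ⟨τ ∗ τ, hτ.conv hτ, by rw [hτ.convSqrt_conv_self]⟩
  · rintro ⟨ν, hν, rfl⟩
    exact ⟨_, hν.convSqrt, rfl⟩

theorem InfDiv.of_mem_U {γ : ℝ} (hγ : 0 < γ) {ρ : Measure (E d)} (h : ρ ∈ U d γ) : InfDiv ρ := by
  obtain ⟨ν, hν, rfl⟩ := h
  exact hν.J hγ

/-- Squaring under convolution cancels the halving by `convSqrt`, leaving the two operators in
opposite order. -/
theorem InfDiv.J_two_mul_J {ν : Measure (E d)} (hν : InfDiv ν) {β : ℝ} (hβ : 0 < β) :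
    FactorizationProperty.J (2 * β) (FactorizationProperty.J β ν) = FactorizationProperty.J β
      (convPow (FactorizationProperty.J (2 * β) (FactorizationProperty.convSqrt ν)) 2) := by
  have hβ2 : 0 < 2 * β := by positivity
  obtain ⟨χ, hχ⟩ := hν.exists_hasExponent
  have h1 := (hν.J hβ).hasExponent_J (hν.hasExponent_J hχ hβ) hβ2
  have h2 := hν.convSqrt.hasExponent_J (hν.hasExponent_convSqrt hχ) hβ2
  rw [integralExponent_div] at h2
  have hinf := hν.convSqrt.J hβ2
  have h3 := h2.convPow 2
  have := hinf.1
  rw [convPow_two] at h3 ⊢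
  have h4 := (hinf.conv hinf).hasExponent_J h3 hβ
  refine h1.measure_eq ?_
  convert h4 using 1
  ext y
  rw [integralExponent_comm hχ.cont hβ2 hβ]
  congr 1
  ext z
  push_cast
  ring

end FactorizationProperty

open FactorizationProperty
/-- The first two conjuncts say that the notation of the other ones is meaningful: for
infinitely divisible `ν` and every `γ > 0` a Lévy process `Y_ν` exists, the law `J^γ(ν)` of the
random integral does not depend on its choice and is infinitely divisible; and `ν` has exactly one
convolution square root, which is infinitely divisible. -/
theorem proposition1 (d : ℕ) (β : ℝ) (hβ : 0 < β) :
    (∀ γ : ℝ, 0 < γ → ∀ ν : Measure (E d), InfDiv ν →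
      (∀ μ : Measure (E d), IsRandomIntegralLaw γ ν μ ↔ μ = J γ ν) ∧ InfDiv (J γ ν)) ∧
    (∀ ν : Measure (E d), InfDiv ν →
      (∀ σ : Measure (E d), IsConvSqrt ν σ ↔ σ = convSqrt ν) ∧ InfDiv (convSqrt ν)) ∧
    (∀ ρ : Measure (E d), InfDiv ρ → (J β ρ ∗ ρ ∈ U d β ↔ ρ ∈ U d (2 * β))) ∧
    (∀ ρ ν : Measure (E d), InfDiv ρ → InfDiv ν →
      (J β ρ ∗ ρ = J β ν ↔ ρ = J (2 * β) (convSqrt ν))) ∧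
    (∀ μ ∈ U d β, ∃ ρ ∈ U d (2 * β),
      μ = J β ρ ∗ ρ ∧
      J (2 * β) μ = J β (convPow ρ 2) ∧
      ∀ ρ' ∈ U d (2 * β), μ = J β ρ' ∗ ρ' → ρ' = ρ) := by
  have hβ2 : 0 < 2 * β := by positivity
  refine ⟨fun γ hγ ν hν => ⟨hν.isRandomIntegralLaw_iff hγ, hν.J hγ⟩,
    fun ν hν => ⟨hν.isConvSqrt_iff, hν.convSqrt⟩, fun ρ hρ => ?_,
    fun ρ ν hρ hν => hρ.J_conv_eq_iff hν hβ, ?_⟩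
  · refine Iff.trans ?_ mem_U_iff_exists_convSqrt.symm
    exact exists_congr fun ν => and_congr_right fun hν => hρ.J_conv_eq_iff hν hβ
  · rintro μ ⟨ν, hν, rfl⟩
    refine ⟨J (2 * β) (convSqrt ν), ⟨_, hν.convSqrt, rfl⟩,
      (((hν.convSqrt.J hβ2).J_conv_eq_iff hν hβ).2 rfl).symm, hν.J_two_mul_J hβ, ?_⟩
    intro ρ' hρ' h
    exact ((InfDiv.of_mem_U hβ2 hρ').J_conv_eq_iff hν hβ).1 h.symm
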